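/- Let $n\ge 2$, let $\mathbb F$ be a field, and consider $n$-Lie algebras over $\mathbb F$: vector spaces with an alternating $n$-linear bracket satisfying $[[x_1,\dots,x_n],y_2,\dots,y_n]=\sum_{i=1}^n[x_1,\dots,[x_i,y_2,\dots,y_n],\dots,x_n]$. For an ideal $I$ of $L$ put $\gamma_1(I,L,\dots,L)=I$ and $\gamma_{c+1}(I,L,\dots,L)=[\gamma_c(I,L,\dots,L),L,\dots,L]$ (the span of all such brackets), and let $L^i=\gamma_i(L,L,\dots,L)$. For a surjective homomorphism $F\to L$ from a free $n$-Lie algebra $F$ (on any set of generators) with kernel $R$, the $2$-nilpotent multiplier of $L$ is the $n$-Lie algebra $$\mathcal M^{(2)}(L)=\frac{R\cap F^3}{\gamma_3(R,F,\dots,F)}.$$ Let $l_d^n(w)$ denote the dimension of $F_d^w/F_d^{w+1}$, where $F_d$ is the free $n$-Lie algebra over $\mathbb F$ on $d$ letters (the number of basic commutators of weight $w$ on $d$ letters), and let $A(k)$ be the abelian $n$-Lie algebra of dimension $k$. An $n$-Lie algebra $L$ with center $Z(L)$ is called Heisenberg if $L^2=Z(L)$ and $\dim L^2=1$. **Theorem.**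 Let $m\ge 2$ and let $H=H(n,m)$ be a Heisenberg $n$-Lie algebra of dimension $mn+1$. Then, for every free presentation $0\to R\to F\to H\to 0$, $$\mathcal M^{(2)}(H)\cong A\bigl(l_{mn}^n(3)\bigr).$$ If $\mathbb F$ has characteristic $0$, then $$l_{mn}^n(3)=\binom{mn}{n}\binom{mn}{n-1}-\binom{mn}{n+1}\binom{mn}{n-2}.$$ Moreover $H/H^2$ is abelian, and the natural map $\mathcal M^{(2)}(H)\to\mathcal M^{(2)}(H/H^2)$, induced by the identity of $F$ (with $\mathcal M^{(2)}(H/H^2)$ computed from the presentation $F\to H\to H/H^2$), is an isomorphism. -/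

import Mathlib

/-- An `n`-Lie algebra (Filippov algebra) over a field `K`: an `n`-ary multilinear alternating
bracket satisfying the generalized Jacobi identity
`[[x₁,…,xₙ],y₂,…,yₙ] = ∑ᵢ [x₁,…,[xᵢ,y₂,…,yₙ],…,xₙ]`.
The tuple `(z,y₂,…,yₙ)` is written `Function.update y j z`, i.e. `z` stands in the `j`-th place and
`y j` is ignored; by skew-symmetry all places `j` give the same identity. -/
class NLieAlgebra (K : Type*) (n : ℕ) (L : Type*) [Field K] [AddCommGroup L] [Module K L] where
  bracket : L [⋀^Fin n]→ₗ[K] L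
  jacobi : ∀ (j : Fin n) (x y : Fin n → L),
    bracket (Function.update y j (bracket x)) =
      ∑ i : Fin n, bracket (Function.update x i (bracket (Function.update y j (x i))))

/-- The bracket `[x₁,…,xₙ]`. -/
abbrev nbr (K : Type*) (n : ℕ) {L : Type*} [Field K] [AddCommGroup L] [Module K L]
    [NLieAlgebra K n L] : L [⋀^Fin n]→ₗ[K] L :=
  NLieAlgebra.bracket

/-- Homomorphisms of `n`-Lie algebras. -/
structure NLieHom (K : Type*) (n : ℕ) (L L' : Type*) [Field K] [AddCommGroup L] [Module K L]
    [NLieAlgebra K n L] [AddCommGroup L'] [Module K L'] [NLieAlgebra K n L'] where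
  toLinearMap : L →ₗ[K] L'
  map_bracket : ∀ x : Fin n → L,
    toLinearMap (nbr K n x) = nbr K n (fun i => toLinearMap (x i))

/-- Isomorphisms of `n`-Lie algebras. -/
structure NLieEquiv (K : Type*) (n : ℕ) (L L' : Type*) [Field K] [AddCommGroup L] [Module K L]
    [NLieAlgebra K n L] [AddCommGroup L'] [Module K L'] [NLieAlgebra K n L'] where
  toLinearEquiv : L ≃ₗ[K] L'
  map_bracket : ∀ x : Fin n → L,
    toLinearEquiv (nbr K n x) = nbr K n (fun i => toLinearEquiv (x i))

/-- Ideals: subspaces `I` with `[I,L,…,L] ⊆ I` (by skew-symmetry the place of the entry from `I`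
is irrelevant). -/
structure NLieIdeal (K : Type*) (n : ℕ) (L : Type*) [Field K] [AddCommGroup L] [Module K L]
    [NLieAlgebra K n L] where
  toSubmodule : Submodule K L
  bracket_mem : ∀ (x : Fin n → L) (i : Fin n), x i ∈ toSubmodule → nbr K n x ∈ toSubmodule

/-- Subalgebras. -/
structure NLieSubalgebra (K : Type*) (n : ℕ) (L : Type*) [Field K] [AddCommGroup L] [Module K L]
    [NLieAlgebra K n L] where
  toSubmodule : Submodule K L
  bracket_mem : ∀ x : Fin n → L, (∀ i, x i ∈ toSubmodule) → nbr K n x ∈ toSubmodule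

section basic

variable {K : Type*} {n : ℕ} {L : Type*} [Field K] [AddCommGroup L] [Module K L]
  [NLieAlgebra K n L]

/-- A subalgebra is an `n`-Lie algebra with the restricted bracket. -/
instance NLieSubalgebra.instNLie (S : NLieSubalgebra K n L) : NLieAlgebra K n S.toSubmodule where
  bracket := ((nbr K n).compLinearMap S.toSubmodule.subtype).codRestrict S.toSubmodule
    (fun x => S.bracket_mem _ (fun i => (x i).2))
  jacobi j x y := by
    apply Subtype.ext
    have h := NLieAlgebra.jacobi (K := K) (n := n) j (fun i => (x i : L)) (fun i => (y i : L))
    have key : ∀ (v : Fin n → S.toSubmodule) (i : Fin n) (z : S.toSubmodule),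
        (fun k => ((Function.update v i z k : S.toSubmodule) : L)) =
          Function.update (fun k => (v k : L)) i (z : L) := by
      intro v i z
      funext k
      by_cases hk : k = i
      · subst hk; simp
      · simp [hk]
    have hB : ∀ v : Fin n → S.toSubmodule,
        (((((nbr K n).compLinearMap S.toSubmodule.subtype).codRestrict S.toSubmodule
          (fun x => S.bracket_mem _ (fun i => (x i).2))) v : S.toSubmodule) : L) =
          nbr K n (fun i => (v i : L)) := fun _ => rfl
    rw [AddSubmonoidClass.coe_finsetSum]
    simp only [hB, key]
    exact h

theorem nbr_sub_mem (I : NLieIdeal K n L) (x y : Fin n → L)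
    (h : ∀ i, x i - y i ∈ I.toSubmodule) : nbr K n x - nbr K n y ∈ I.toSubmodule := by
  have key : ∀ s : Finset (Fin n),
      nbr K n (s.piecewise x y) - nbr K n y ∈ I.toSubmodule := by
    intro s
    induction s using Finset.induction_on with
    | empty => simp
    | insert a s ha ih =>
      have h1 : nbr K n (Function.update (s.piecewise x y) a (x a)) -
          nbr K n (Function.update (s.piecewise x y) a (y a)) ∈ I.toSubmodule := by
        rw [← AlternatingMap.map_update_sub]
        exact I.bracket_mem _ a (by simpa using h a)
      have h2 : Function.update (s.piecewise x y) a (y a) = s.piecewise x y := by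
        apply Function.update_eq_self_iff.2
        simp [ha]
      rw [h2] at h1
      rw [Finset.piecewise_insert]
      simpa using I.toSubmodule.add_mem h1 ih
  simpa using key Finset.univ

theorem mk_nbr_out (I : NLieIdeal K n L) (x : Fin n → L) :
    I.toSubmodule.mkQ (nbr K n (fun i => (I.toSubmodule.mkQ (x i)).out)) =
      I.toSubmodule.mkQ (nbr K n x) := by
  simp only [Submodule.mkQ_apply]
  rw [Submodule.Quotient.eq]
  apply nbr_sub_mem
  intro i
  rw [← Submodule.Quotient.eq]
  exact Quotient.out_eq' _

/-- The bracket induced on the quotient by an ideal: `[x₁+I,…,xₙ+I] = [x₁,…,xₙ]+I`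
(see `quotBracket_mk`). -/
noncomputable def quotBracket (I : NLieIdeal K n L) :
    (L ⧸ I.toSubmodule) [⋀^Fin n]→ₗ[K] (L ⧸ I.toSubmodule) where
  toFun v := I.toSubmodule.mkQ (nbr K n (fun i => (v i).out))
  map_update_add' := by
    intro inst v i a b
    obtain ⟨w, rfl⟩ : ∃ w : Fin n → L, (fun k => I.toSubmodule.mkQ (w k)) = v :=
      ⟨fun k => (v k).out, funext fun k => Quotient.out_eq' _⟩
    obtain ⟨a, rfl⟩ := I.toSubmodule.mkQ_surjective a
    obtain ⟨b, rfl⟩ := I.toSubmodule.mkQ_surjective b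
    have key : ∀ z : L, Function.update (fun k => I.toSubmodule.mkQ (w k)) i
        (I.toSubmodule.mkQ z) = fun k => I.toSubmodule.mkQ (Function.update w i z k) := by
      intro z
      funext k
      by_cases hk : k = i
      · subst hk; simp
      · simp [hk]
    rw [← map_add, key, key, key, mk_nbr_out, mk_nbr_out, mk_nbr_out, ← map_add,
      AlternatingMap.map_update_add]
  map_update_smul' := by
    intro inst v i c a
    obtain ⟨w, rfl⟩ : ∃ w : Fin n → L, (fun k => I.toSubmodule.mkQ (w k)) = v :=
      ⟨fun k => (v k).out, funext fun k => Quotient.out_eq' _⟩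
    obtain ⟨a, rfl⟩ := I.toSubmodule.mkQ_surjective a
    have key : ∀ z : L, Function.update (fun k => I.toSubmodule.mkQ (w k)) i
        (I.toSubmodule.mkQ z) = fun k => I.toSubmodule.mkQ (Function.update w i z k) := by
      intro z
      funext k
      by_cases hk : k = i
      · subst hk; simp
      · simp [hk]
    rw [← map_smul, key, key, mk_nbr_out, mk_nbr_out, ← map_smul,
      AlternatingMap.map_update_smul]
  map_eq_zero_of_eq' := by
    intro v i j h hij
    have : nbr K n (fun i => (v i).out) = 0 :=
      AlternatingMap.map_eq_zero_of_eq _ _ (congrArg Quotient.out h) hij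
    rw [this, map_zero]

theorem quotBracket_mk (I : NLieIdeal K n L) (x : Fin n → L) :
    quotBracket I (fun i => I.toSubmodule.mkQ (x i)) = I.toSubmodule.mkQ (nbr K n x) :=
  mk_nbr_out I x

/-- The quotient `n`-Lie algebra `L/I`. -/
noncomputable instance NLieIdeal.instNLieQuot (I : NLieIdeal K n L) :
    NLieAlgebra K n (L ⧸ I.toSubmodule) where
  bracket := quotBracket I
  jacobi := by
    intro j v u
    obtain ⟨x, rfl⟩ : ∃ w : Fin n → L, (fun k => I.toSubmodule.mkQ (w k)) = v :=
      ⟨fun k => (v k).out, funext fun k => Quotient.out_eq' _⟩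
    obtain ⟨y, rfl⟩ : ∃ w : Fin n → L, (fun k => I.toSubmodule.mkQ (w k)) = u :=
      ⟨fun k => (u k).out, funext fun k => Quotient.out_eq' _⟩
    have key : ∀ (w : Fin n → L) (i : Fin n) (z : L),
        Function.update (fun k => I.toSubmodule.mkQ (w k)) i
        (I.toSubmodule.mkQ z) = fun k => I.toSubmodule.mkQ (Function.update w i z k) := by
      intro w i z
      funext k
      by_cases hk : k = i
      · subst hk; simp
      · simp [hk]
    simp only [quotBracket_mk, key]
    rw [NLieAlgebra.jacobi j x y, map_sum]

variable (K n L)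

/-- The improper ideal `L`. -/
def topIdeal : NLieIdeal K n L := ⟨⊤, fun _ _ _ => trivial⟩

/-- The center `Z(L) = {z : [z,L,…,L] = 0}`. -/
def nCenter : NLieIdeal K n L where
  toSubmodule :=
    { carrier := {z | ∀ (x : Fin n → L) (i : Fin n), nbr K n (Function.update x i z) = 0}
      zero_mem' := fun x i => by simp
      add_mem' := fun {a b} ha hb x i => by
        rw [AlternatingMap.map_update_add, ha x i, hb x i, add_zero]
      smul_mem' := fun c a ha x i => by
        rw [AlternatingMap.map_update_smul, ha x i, smul_zero] }
  bracket_mem := by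
    intro x i hi y j
    have h : nbr K n x = 0 := by simpa using hi x i
    rw [h]
    simp

variable {K n L}

/-- `[I,L,…,L]`, spanned by all brackets with an entry in the ideal `I`; it is again an ideal. -/
def bracketIdeal (I : NLieIdeal K n L) : NLieIdeal K n L where
  toSubmodule := Submodule.span K
    {z | ∃ x : Fin n → L, (∃ i, x i ∈ I.toSubmodule) ∧ nbr K n x = z}
  bracket_mem := by
    intro x i hi
    have key : ∀ w ∈ Submodule.span K
        {z | ∃ x : Fin n → L, (∃ i, x i ∈ I.toSubmodule) ∧ nbr K n x = z},
        nbr K n (Function.update x i w) ∈ Submodule.span K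
        {z | ∃ x : Fin n → L, (∃ i, x i ∈ I.toSubmodule) ∧ nbr K n x = z} := by
      intro w hw
      induction hw using Submodule.span_induction with
      | mem w hw =>
        obtain ⟨y, ⟨j, hj⟩, rfl⟩ := hw
        rw [NLieAlgebra.jacobi i y x]
        refine Submodule.sum_mem _ fun k _ => Submodule.subset_span ⟨_, ⟨j, ?_⟩, rfl⟩
        by_cases hk : j = k
        · subst hk
          rw [Function.update_self]
          exact I.bracket_mem _ i (by simpa using hj)
        · rw [Function.update_of_ne hk]
          exact hj
      | zero => simp
      | add a b _ _ ha hb =>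
        rw [AlternatingMap.map_update_add]
        exact Submodule.add_mem _ ha hb
      | smul c a _ ha =>
        rw [AlternatingMap.map_update_smul]
        exact Submodule.smul_mem _ c ha
    simpa using key (x i) hi

/-- `γ_{c+1}(I,L,…,L) = [[…[I,L,…,L],…],L,…,L]` with `c` brackets. -/
def gammaSucc (I : NLieIdeal K n L) : ℕ → NLieIdeal K n L
  | 0 => I
  | c + 1 => bracketIdeal (gammaSucc I c)

variable (K n L)

/-- The term `L^i` (`i ≥ 1`) of the lower central series:
`L^1 = L` and `L^{i+1} = [L^i,L,…,L]`. -/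
def lowerCentral (i : ℕ) : NLieIdeal K n L := gammaSucc (topIdeal K n L) (i - 1)

/-- `L` is a Heisenberg `n`-Lie algebra: `L^2 = Z(L)` and `dim L^2 = 1`. -/
def IsHeisenberg : Prop :=
  (lowerCentral K n L 2).toSubmodule = (nCenter K n L).toSubmodule ∧
    Module.finrank K (lowerCentral K n L 2).toSubmodule = 1

variable {K n L}

/-- The projection `L → L/I`. -/
noncomputable def quotHom (I : NLieIdeal K n L) : NLieHom K n L (L ⧸ I.toSubmodule) where
  toLinearMap := I.toSubmodule.mkQ
  map_bracket x := (quotBracket_mk I x).symm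

/-- The kernel of a homomorphism. -/
def NLieHom.ker {L' : Type*} [AddCommGroup L'] [Module K L'] [NLieAlgebra K n L']
    (f : NLieHom K n L L') : NLieIdeal K n L where
  toSubmodule := LinearMap.ker f.toLinearMap
  bracket_mem x i hi := by
    rw [LinearMap.mem_ker] at hi ⊢
    rw [f.map_bracket]
    exact AlternatingMap.map_coord_zero _ i hi

/-- Composition of homomorphisms. -/
def NLieHom.comp {L' L'' : Type*} [AddCommGroup L'] [Module K L'] [NLieAlgebra K n L']
    [AddCommGroup L''] [Module K L''] [NLieAlgebra K n L'']
    (g : NLieHom K n L' L'') (f : NLieHom K n L L') : NLieHom K n L L'' where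
  toLinearMap := g.toLinearMap.comp f.toLinearMap
  map_bracket x := by simp [f.map_bracket, g.map_bracket]

/-- For a surjection `π : F → L` with kernel `R`, where `F` is free, this is the `c`-nilpotent
multiplier `(R ∩ F^{c+1}) / γ_{c+1}(R,F,…,F)` of `L`, as a subalgebra of
`F / γ_{c+1}(R,F,…,F)`. (For an ideal `R` one has `γ_{c+1}(R,F,…,F) ⊆ R ∩ F^{c+1}`.) -/
noncomputable def nilMultiplier [NeZero n] {L' : Type*} [AddCommGroup L'] [Module K L'] [NLieAlgebra K n L']
    (c : ℕ) (π : NLieHom K n L L') :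
    NLieSubalgebra K n (L ⧸ (gammaSucc π.ker c).toSubmodule) where
  toSubmodule := (π.ker.toSubmodule ⊓ (lowerCentral K n L (c + 1)).toSubmodule).map
    (gammaSucc π.ker c).toSubmodule.mkQ
  bracket_mem := by
    intro v hv
    choose w hw hwv using hv
    obtain rfl : (fun i => (gammaSucc π.ker c).toSubmodule.mkQ (w i)) = v := funext hwv
    refine ⟨nbr K n w, ?_, (quotBracket_mk _ w).symm⟩
    exact ⟨π.ker.bracket_mem w 0 (hw 0).1, (lowerCentral K n L (c + 1)).bracket_mem w 0 (hw 0).2⟩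

end basic

/-- Formal `n`-Lie expressions in letters from `X`. -/
inductive PreNLie (K : Type*) (n : ℕ) (X : Type*) where
  | of : X → PreNLie K n X
  | zero : PreNLie K n X
  | add : PreNLie K n X → PreNLie K n X → PreNLie K n X
  | smul : K → PreNLie K n X → PreNLie K n X
  | bracket : (Fin n → PreNLie K n X) → PreNLie K n X

/-- The formal sum of a family of expressions. -/
def PreNLie.sum {K : Type*} {n : ℕ} {X : Type*} {k : ℕ} (f : Fin k → PreNLie K n X) :
    PreNLie K n X :=
  (List.ofFn f).foldr PreNLie.add PreNLie.zero

/-- The smallest congruence on formal expressions that enforces the axioms of an `n`-Lie algebra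
over `K`. -/
inductive NLieRel (K : Type*) [Field K] (n : ℕ) (X : Type*) :
    PreNLie K n X → PreNLie K n X → Prop
  | refl (a) : NLieRel K n X a a
  | symm {a b} : NLieRel K n X a b → NLieRel K n X b a
  | trans {a b c} : NLieRel K n X a b → NLieRel K n X b c → NLieRel K n X a c
  | add_congr {a a' b b'} : NLieRel K n X a a' → NLieRel K n X b b' →
      NLieRel K n X (.add a b) (.add a' b')
  | smul_congr (c : K) {a a'} : NLieRel K n X a a' → NLieRel K n X (.smul c a) (.smul c a')
  | bracket_congr {v w : Fin n → PreNLie K n X} : (∀ i, NLieRel K n X (v i) (w i)) →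
      NLieRel K n X (.bracket v) (.bracket w)
  | add_assoc (a b c) : NLieRel K n X (.add (.add a b) c) (.add a (.add b c))
  | add_comm (a b) : NLieRel K n X (.add a b) (.add b a)
  | zero_add (a) : NLieRel K n X (.add .zero a) a
  | zero_smul (a) : NLieRel K n X (.smul 0 a) .zero
  | one_smul (a) : NLieRel K n X (.smul 1 a) a
  | mul_smul (c d : K) (a) : NLieRel K n X (.smul (c * d) a) (.smul c (.smul d a))
  | smul_add (c : K) (a b) : NLieRel K n X (.smul c (.add a b)) (.add (.smul c a) (.smul c b))
  | add_smul (c d : K) (a) : NLieRel K n X (.smul (c + d) a) (.add (.smul c a) (.smul d a))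
  | bracket_add (v : Fin n → PreNLie K n X) (i : Fin n) (a b) :
      NLieRel K n X (.bracket (Function.update v i (.add a b)))
        (.add (.bracket (Function.update v i a)) (.bracket (Function.update v i b)))
  | bracket_smul (v : Fin n → PreNLie K n X) (i : Fin n) (c : K) (a) :
      NLieRel K n X (.bracket (Function.update v i (.smul c a)))
        (.smul c (.bracket (Function.update v i a)))
  | bracket_alt (v : Fin n → PreNLie K n X) (i j : Fin n) : i ≠ j → v i = v j →
      NLieRel K n X (.bracket v) .zero
  | jacobi (j : Fin n) (x y : Fin n → PreNLie K n X) :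
      NLieRel K n X (.bracket (Function.update y j (.bracket x)))
        (PreNLie.sum fun i : Fin n =>
          .bracket (Function.update x i (.bracket (Function.update y j (x i)))))

/-- The congruence as a setoid. -/
def nLieSetoid (K : Type*) [Field K] (n : ℕ) (X : Type*) : Setoid (PreNLie K n X) :=
  ⟨NLieRel K n X, ⟨NLieRel.refl, NLieRel.symm, NLieRel.trans⟩⟩

/-- The free `n`-Lie algebra over `K` on the set `X`. -/
def FreeNLie (K : Type*) [Field K] (n : ℕ) (X : Type*) : Type _ :=
  Quotient (nLieSetoid K n X)

namespace FreeNLie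

variable {K : Type*} [Field K] {n : ℕ} {X : Type*}

/-- The class of a formal expression. -/
def mk (a : PreNLie K n X) : FreeNLie K n X := Quotient.mk _ a

theorem mk_eq {a b : PreNLie K n X} (h : NLieRel K n X a b) : mk a = mk b :=
  Quotient.sound (s := nLieSetoid K n X) h

theorem mk_surj (a : FreeNLie K n X) : ∃ p, mk p = a := Quotient.exists_rep a

theorem mk_rel {a b : PreNLie K n X} (h : mk a = mk b) : NLieRel K n X a b :=
  Quotient.exact (s := nLieSetoid K n X) h

/-- The free generators. -/
def of (x : X) : FreeNLie K n X := mk (.of x)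

instance : Zero (FreeNLie K n X) := ⟨mk .zero⟩

instance : Add (FreeNLie K n X) :=
  ⟨Quotient.map₂ PreNLie.add fun _ _ h _ _ h' => NLieRel.add_congr h h'⟩

instance : SMul K (FreeNLie K n X) :=
  ⟨fun c => Quotient.map (PreNLie.smul c) fun _ _ h => NLieRel.smul_congr c h⟩

instance : Neg (FreeNLie K n X) := ⟨fun a => (-1 : K) • a⟩

theorem mk_zero : (mk .zero : FreeNLie K n X) = 0 := rfl

theorem mk_add (a b : PreNLie K n X) : mk (.add a b) = mk a + mk b := rfl

theorem mk_smul (c : K) (a : PreNLie K n X) : mk (.smul c a) = c • mk a := rfl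

instance : AddCommGroup (FreeNLie K n X) where
  add_assoc a b c := by
    obtain ⟨a, rfl⟩ := mk_surj a
    obtain ⟨b, rfl⟩ := mk_surj b
    obtain ⟨c, rfl⟩ := mk_surj c
    exact mk_eq (.add_assoc a b c)
  zero_add a := by
    obtain ⟨a, rfl⟩ := mk_surj a
    exact mk_eq (.zero_add a)
  add_zero a := by
    obtain ⟨a, rfl⟩ := mk_surj a
    exact mk_eq (.trans (.add_comm _ _) (.zero_add a))
  add_comm a b := by
    obtain ⟨a, rfl⟩ := mk_surj a
    obtain ⟨b, rfl⟩ := mk_surj b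
    exact mk_eq (.add_comm a b)
  neg_add_cancel a := by
    obtain ⟨a, rfl⟩ := mk_surj a
    change mk (.add (.smul (-1) a) a) = mk .zero
    have h : mk (.add (.smul (-1) a) a) = mk (.smul (-1 + 1) a) :=
      mk_eq (.symm (.trans (.add_smul _ _ _) (.add_congr (.refl _) (.one_smul a))))
    rw [h, neg_add_cancel]
    exact mk_eq (.zero_smul a)
  nsmul := nsmulRec
  zsmul := zsmulRec

instance : Module K (FreeNLie K n X) where
  one_smul a := by
    obtain ⟨a, rfl⟩ := mk_surj a
    exact mk_eq (.one_smul a)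
  mul_smul c d a := by
    obtain ⟨a, rfl⟩ := mk_surj a
    exact mk_eq (.mul_smul c d a)
  smul_zero c := by
    change mk (.smul c .zero) = mk .zero
    refine mk_eq (.trans (.smul_congr c (.symm (.zero_smul .zero))) ?_)
    refine .trans (.symm (.mul_smul c 0 .zero)) ?_
    rw [mul_zero]
    exact .zero_smul _
  smul_add c a b := by
    obtain ⟨a, rfl⟩ := mk_surj a
    obtain ⟨b, rfl⟩ := mk_surj b
    exact mk_eq (.smul_add c a b)
  add_smul c d a := by
    obtain ⟨a, rfl⟩ := mk_surj a
    exact mk_eq (.add_smul c d a)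
  zero_smul a := by
    obtain ⟨a, rfl⟩ := mk_surj a
    exact mk_eq (.zero_smul a)

theorem mk_sum {k : ℕ} (f : Fin k → PreNLie K n X) : mk (PreNLie.sum f) = ∑ i, mk (f i) := by
  have h : ∀ l : List (PreNLie K n X),
      mk (l.foldr PreNLie.add PreNLie.zero) = (l.map mk).sum := by
    intro l
    induction l with
    | nil => rfl
    | cons a l ih => simp [mk_add, ih]
  rw [PreNLie.sum, h, List.map_ofFn, List.sum_ofFn]
  rfl

/-- The bracket on classes; `br (mk ∘ v) = mk (bracket v)` by `br_mk`. -/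
noncomputable def br (v : Fin n → FreeNLie K n X) : FreeNLie K n X :=
  mk (.bracket fun i => (v i).out)

theorem br_mk (v : Fin n → PreNLie K n X) : br (fun i => mk (v i)) = mk (.bracket v) :=
  mk_eq (.bracket_congr fun _ => mk_rel (Quotient.out_eq _))

theorem exists_rep_fun (v : Fin n → FreeNLie K n X) :
    ∃ w : Fin n → PreNLie K n X, (fun i => mk (w i)) = v :=
  ⟨fun i => (v i).out, funext fun _ => Quotient.out_eq _⟩

theorem update_mk (w : Fin n → PreNLie K n X) (i : Fin n) (a : PreNLie K n X) :
    Function.update (fun k => mk (w k)) i (mk a) = fun k => mk (Function.update w i a k) := by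
  funext k
  by_cases hk : k = i
  · subst hk; simp
  · simp [hk]

noncomputable instance : NLieAlgebra K n (FreeNLie K n X) where
  bracket :=
    { toFun := br
      map_update_add' := by
        intro inst v i a b
        obtain rfl : inst = instDecidableEqFin n := Subsingleton.elim _ _
        obtain ⟨w, rfl⟩ := exists_rep_fun v
        obtain ⟨a, rfl⟩ := mk_surj a
        obtain ⟨b, rfl⟩ := mk_surj b
        rw [← mk_add, update_mk, update_mk, update_mk, br_mk, br_mk, br_mk]
        exact mk_eq (.bracket_add w i a b)
      map_update_smul' := by
        intro inst v i c a
        obtain rfl : inst = instDecidableEqFin n := Subsingleton.elim _ _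
        obtain ⟨w, rfl⟩ := exists_rep_fun v
        obtain ⟨a, rfl⟩ := mk_surj a
        rw [← mk_smul, update_mk, update_mk, br_mk, br_mk]
        exact mk_eq (.bracket_smul w i c a)
      map_eq_zero_of_eq' := by
        intro v i j h hij
        exact mk_eq (.bracket_alt _ i j hij (congrArg Quotient.out h)) }
  jacobi := by
    intro j v u
    obtain ⟨x, rfl⟩ := exists_rep_fun v
    obtain ⟨y, rfl⟩ := exists_rep_fun u
    change br (Function.update _ j (br _)) =
      ∑ i : Fin n, br (Function.update _ i (br (Function.update _ j _)))
    simp only [br_mk, update_mk]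
    rw [mk_eq (.jacobi j x y), mk_sum]

end FreeNLie

/-- The abelian `n`-Lie algebra `A(d)` of dimension `d`: the space `K^d` with zero bracket. -/
def AbelianNLie (K : Type*) (_n : ℕ) (d : ℕ) : Type _ := Fin d → K

instance (K : Type*) [Field K] (n d : ℕ) : AddCommGroup (AbelianNLie K n d) :=
  inferInstanceAs (AddCommGroup (Fin d → K))

instance (K : Type*) [Field K] (n d : ℕ) : Module K (AbelianNLie K n d) :=
  inferInstanceAs (Module K (Fin d → K))

instance (K : Type*) [Field K] (n d : ℕ) : NLieAlgebra K n (AbelianNLie K n d) where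
  bracket := 0
  jacobi := by simp

/-- `l_d^n(w)` for `w ≥ 1`: the dimension of `F^w / F^{w+1}`, where `F` is the free `n`-Lie algebra
over `K` on `d` letters. -/
noncomputable def basicNumber (K : Type*) [Field K] (n d w : ℕ) : ℕ :=
  Module.finrank K
    ((lowerCentral K n (FreeNLie K n (Fin d)) w).toSubmodule ⧸
      (lowerCentral K n (FreeNLie K n (Fin d)) (w + 1)).toSubmodule.submoduleOf
        (lowerCentral K n (FreeNLie K n (Fin d)) w).toSubmodule)

/-! ### Brackets of ideals and congruences modulo them -/

section ideals

variable {K : Type*} {n : ℕ} {L : Type*} [Field K] [AddCommGroup L] [Module K L]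
  [NLieAlgebra K n L]

/-! Write `H = F/R` and `S = R + F²`, the kernel of `F → H/H²`. Everything rests on `F³ ⊆ [R,F,…,F]`
(`lowerCentral_three_le_bracketIdeal_ker`). If some `[u,y₀]` with `u ∈ F²` escaped, a functional `λ`
killing `[R,F,…,F]` but not `[u,y₀]` would turn the Jacobi identity into a relation between the
structure form `ω` of `H` and `τ(y) = λ[u,y]`. That relation makes the center of `H` the solution
space of at most `n` linear equations up to containment, so `dim H ≤ n + 1`, which `m ≥ 2` excludes.

It follows that `[S,F,…,F] = [R,F,…,F]`, hence `γ₃(S,F,…,F) = γ₃(R,F,…,F)`. Since also `F³ ⊆ R`,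
both multipliers are `F³/γ₃(S,F,…,F)`, and their brackets vanish because `F⁴ ⊆ γ₃(R,F,…,F)`.
Homomorphisms that agree modulo `J` agree on `F³` modulo `γ₃(J,F,…,F)`, so lifting a basis of `H/H²`
identifies this space with `F_d³/F_d⁴`, `d = mn` (`exists_lowerCentralQuot_equiv`). All of this
holds over any field.

For the dimension put `n = p + 1`. The dual of `F_d³/F_d⁴` consists of the forms `β(x;y)`,
alternating in `p + 1` and in `p` variables, that satisfy the identity forced by Jacobi on
`[[x],y]`; each is realized by a nilpotent algebra on `V ⊕ Λ^{p+1}V ⊕ K`. The two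
antisymmetrizations `raise` and `lower` obey an `sl₂` commutation rule (`lower_raise`). In
characteristic zero it shows that `raise` is onto, and, together with an induction on `p`, that the
Jacobi forms are exactly its kernel (`jacobiForms_eq_ker_raise`). Rank-nullity gives the binomial
formula. -/

theorem nbr_mem_bracketIdeal (I : NLieIdeal K n L) {x : Fin n → L} (i : Fin n)
    (hi : x i ∈ I.toSubmodule) : nbr K n x ∈ (bracketIdeal I).toSubmodule :=
  Submodule.subset_span ⟨x, ⟨i, hi⟩, rfl⟩

theorem bracketIdeal_le {I : NLieIdeal K n L} {P : Submodule K L}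
    (h : ∀ (x : Fin n → L) (i : Fin n), x i ∈ I.toSubmodule → nbr K n x ∈ P) :
    (bracketIdeal I).toSubmodule ≤ P :=
  Submodule.span_le.2 (by rintro _ ⟨x, ⟨i, hi⟩, rfl⟩; exact h x i hi)

theorem bracketIdeal_mono {I J : NLieIdeal K n L} (h : I.toSubmodule ≤ J.toSubmodule) :
    (bracketIdeal I).toSubmodule ≤ (bracketIdeal J).toSubmodule :=
  bracketIdeal_le fun _ i hi => nbr_mem_bracketIdeal J i (h hi)

theorem bracketIdeal_le_self (I : NLieIdeal K n L) :
    (bracketIdeal I).toSubmodule ≤ I.toSubmodule :=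
  bracketIdeal_le fun x i hi => I.bracket_mem x i hi

theorem NLieIdeal.ext {I J : NLieIdeal K n L} (h : I.toSubmodule = J.toSubmodule) : I = J := by
  cases I
  cases J
  cases h
  rfl

/-- `[I, L², L, …, L] ⊆ γ₃(I, L, …, L)`. -/
theorem nbr_mem_gammaSucc_two (I : NLieIdeal K n L) {x : Fin n → L} {i j : Fin n} (hij : i ≠ j)
    (hi : x i ∈ I.toSubmodule) (hj : x j ∈ (bracketIdeal (topIdeal K n L)).toSubmodule) :
    nbr K n x ∈ (gammaSucc I 2).toSubmodule := by
  have key : ∀ w ∈ (bracketIdeal (topIdeal K n L)).toSubmodule,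
      nbr K n (Function.update x j w) ∈ (gammaSucc I 2).toSubmodule := by
    intro w hw
    induction hw using Submodule.span_induction with
    | mem w hw =>
      obtain ⟨a, -, rfl⟩ := hw
      -- Every inner bracket on the right keeps the entry `x i` from `I`, so it lies in `[I,L,…,L]`.
      rw [NLieAlgebra.jacobi j a x]
      refine Submodule.sum_mem _ fun k _ => nbr_mem_bracketIdeal _ k ?_
      rw [Function.update_self]
      exact nbr_mem_bracketIdeal _ i (by rwa [Function.update_of_ne hij])
    | zero => simp
    | add a b _ _ ha hb =>
      rw [AlternatingMap.map_update_add]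
      exact Submodule.add_mem _ ha hb
    | smul c a _ ha =>
      rw [AlternatingMap.map_update_smul]
      exact Submodule.smul_mem _ c ha
  simpa using key _ hj

/-- A difference of two brackets lies in `P` as soon as all mixed brackets with one entry replaced
by the difference do. -/
theorem nbr_sub_mem_of (P : Submodule K L) (x y : Fin n → L)
    (h : ∀ (s : Finset (Fin n)) (k : Fin n), k ∉ s →
      nbr K n (Function.update (s.piecewise x y) k (x k - y k)) ∈ P) :
    nbr K n x - nbr K n y ∈ P := by
  have key : ∀ s : Finset (Fin n), nbr K n (s.piecewise x y) - nbr K n y ∈ P := by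
    intro s
    induction s using Finset.induction_on with
    | empty => simp
    | insert a s ha ih =>
      have h1 := h s a ha
      rw [AlternatingMap.map_update_sub] at h1
      have h2 : Function.update (s.piecewise x y) a (y a) = s.piecewise x y := by
        apply Function.update_eq_self_iff.2
        simp [ha]
      rw [h2] at h1
      rw [Finset.piecewise_insert]
      simpa using P.add_mem h1 ih
  simpa using key Finset.univ

theorem nbr_sub_mem_bracketIdeal (J : NLieIdeal K n L) {x y : Fin n → L}
    (h : ∀ k, x k - y k ∈ J.toSubmodule) :
    nbr K n x - nbr K n y ∈ (bracketIdeal J).toSubmodule := by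
  refine nbr_sub_mem_of _ _ _ fun s k _ => nbr_mem_bracketIdeal J k ?_
  rw [Function.update_self]
  exact h k

/-- If two tuples agree modulo `J`, and their `i`-th entries lie in `L²` and agree modulo
`[J, L, …, L]`, then their brackets agree modulo `γ₃(J, L, …, L)`. -/
theorem nbr_sub_mem_gammaSucc_two (J : NLieIdeal K n L) {x y : Fin n → L} (i : Fin n)
    (hx : x i ∈ (bracketIdeal (topIdeal K n L)).toSubmodule)
    (hy : y i ∈ (bracketIdeal (topIdeal K n L)).toSubmodule)
    (hi : x i - y i ∈ (bracketIdeal J).toSubmodule) (h : ∀ k, x k - y k ∈ J.toSubmodule) :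
    nbr K n x - nbr K n y ∈ (gammaSucc J 2).toSubmodule := by
  refine nbr_sub_mem_of _ _ _ fun s k _ => ?_
  by_cases hki : i = k
  · subst hki
    refine nbr_mem_bracketIdeal _ i ?_
    rw [Function.update_self]
    exact hi
  · refine nbr_mem_gammaSucc_two J (i := k) (j := i) (Ne.symm hki) ?_ ?_
    · rw [Function.update_self]
      exact h k
    · rw [Function.update_of_ne hki]
      by_cases his : i ∈ s
      · rwa [Finset.piecewise_eq_of_mem _ _ _ his]
      · rwa [Finset.piecewise_eq_of_notMem _ _ _ his]

variable {L' : Type*} [AddCommGroup L'] [Module K L'] [NLieAlgebra K n L']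

theorem NLieHom.map_bracketIdeal (f : NLieHom K n L L') {I : NLieIdeal K n L}
    {J : NLieIdeal K n L'} (h : ∀ a ∈ I.toSubmodule, f.toLinearMap a ∈ J.toSubmodule) :
    ∀ a ∈ (bracketIdeal I).toSubmodule, f.toLinearMap a ∈ (bracketIdeal J).toSubmodule := by
  have : (bracketIdeal I).toSubmodule ≤ (bracketIdeal J).toSubmodule.comap f.toLinearMap := by
    refine bracketIdeal_le fun x i hi => ?_
    rw [Submodule.mem_comap, f.map_bracket]
    exact nbr_mem_bracketIdeal J i (h _ hi)
  exact this

theorem NLieHom.map_gammaSucc (f : NLieHom K n L L') {I : NLieIdeal K n L}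
    {J : NLieIdeal K n L'} (h : ∀ a ∈ I.toSubmodule, f.toLinearMap a ∈ J.toSubmodule) (c : ℕ) :
    ∀ a ∈ (gammaSucc I c).toSubmodule, f.toLinearMap a ∈ (gammaSucc J c).toSubmodule := by
  induction c with
  | zero => exact h
  | succ c ih => exact f.map_bracketIdeal ih

/-- Two homomorphisms which agree modulo `J` agree on `L³` modulo `γ₃(J, L', …, L')`. -/
theorem NLieHom.sub_mem_gammaSucc_two (f g : NLieHom K n L L') (J : NLieIdeal K n L')
    (h : ∀ a, f.toLinearMap a - g.toLinearMap a ∈ J.toSubmodule) :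
    ∀ a ∈ (gammaSucc (topIdeal K n L) 2).toSubmodule,
      f.toLinearMap a - g.toLinearMap a ∈ (gammaSucc J 2).toSubmodule := by
  have h2 : ∀ a ∈ (bracketIdeal (topIdeal K n L)).toSubmodule,
      f.toLinearMap a - g.toLinearMap a ∈ (bracketIdeal J).toSubmodule := by
    have : (bracketIdeal (topIdeal K n L)).toSubmodule ≤
        (bracketIdeal J).toSubmodule.comap (f.toLinearMap - g.toLinearMap) := by
      refine bracketIdeal_le fun x i _ => ?_
      rw [Submodule.mem_comap, LinearMap.sub_apply, f.map_bracket, g.map_bracket]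
      exact nbr_sub_mem_bracketIdeal J fun k => h _
    exact this
  have h3 : (gammaSucc (topIdeal K n L) 2).toSubmodule ≤
      (gammaSucc J 2).toSubmodule.comap (f.toLinearMap - g.toLinearMap) := by
    refine bracketIdeal_le fun x i hi => ?_
    rw [Submodule.mem_comap, LinearMap.sub_apply, f.map_bracket, g.map_bracket]
    exact nbr_sub_mem_gammaSucc_two J i
      (f.map_bracketIdeal (J := topIdeal K n L') (fun _ _ => trivial) _ hi)
      (g.map_bracketIdeal (J := topIdeal K n L') (fun _ _ => trivial) _ hi) (h2 _ hi) fun k => h _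
  exact h3

end ideals

/-! ### The Jacobi identity with signs, inner bracket in first place -/

section jacobi

variable {K : Type*} {p : ℕ} {L : Type*} [Field K] [AddCommGroup L] [Module K L]

theorem AlternatingMap.map_update_eq_removeNth {N : Type*} [AddCommGroup N] [Module K N]
    (f : L [⋀^Fin (p + 1)]→ₗ[K] N) (x : Fin (p + 1) → L) (i : Fin (p + 1)) (z : L) :
    f (Function.update x i z) = (-1) ^ (i : ℕ) • f (Matrix.vecCons z (i.removeNth x)) := by
  rw [← AlternatingMap.map_insertNth, Fin.insertNth_removeNth]

theorem AlternatingMap.map_eq_removeNth {N : Type*} [AddCommGroup N] [Module K N]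
    (f : L [⋀^Fin (p + 1)]→ₗ[K] N) (x : Fin (p + 1) → L) (i : Fin (p + 1)) :
    f x = (-1) ^ (i : ℕ) • f (Matrix.vecCons (x i) (i.removeNth x)) := by
  rw [← AlternatingMap.map_update_eq_removeNth, Function.update_eq_self]

theorem update_vecCons_zero {α : Type*} (a b : α) (y : Fin p → α) :
    Function.update (Matrix.vecCons a y) 0 b = Matrix.vecCons b y :=
  Fin.update_cons_zero (α := fun _ => α) a y b

theorem removeNth_zero_vecCons {α : Type*} (a : α) (y : Fin p → α) :
    Fin.removeNth (α := fun _ => α) 0 (Matrix.vecCons a y) = y := rfl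

theorem removeNth_succ_vecCons {α : Type*} (a : α) (y : Fin (p + 1) → α) (i : Fin (p + 1)) :
    Fin.removeNth (α := fun _ => α) i.succ (Matrix.vecCons a y) =
      Matrix.vecCons a (i.removeNth y) := by
  funext j
  refine Fin.cases ?_ (fun k => ?_) j
  · simp [Fin.removeNth]
  · simp [Fin.removeNth]

variable [NLieAlgebra K (p + 1) L]

theorem nbr_vecCons_nbr (x : Fin (p + 1) → L) (y : Fin p → L) :
    nbr K (p + 1) (Matrix.vecCons (nbr K (p + 1) x) y) =
      ∑ i : Fin (p + 1), (-1) ^ (i : ℕ) • nbr K (p + 1)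
        (Matrix.vecCons (nbr K (p + 1) (Matrix.vecCons (x i) y)) (i.removeNth x)) := by
  have h := NLieAlgebra.jacobi (K := K) 0 x (Matrix.vecCons 0 y)
  simp only [update_vecCons_zero] at h
  rw [h]
  exact Finset.sum_congr rfl fun i _ => AlternatingMap.map_update_eq_removeNth _ _ _ _

theorem bracketIdeal_le_of_vecCons {I : NLieIdeal K (p + 1) L} {P : Submodule K L}
    (h : ∀ u ∈ I.toSubmodule, ∀ y : Fin p → L, nbr K (p + 1) (Matrix.vecCons u y) ∈ P) :
    (bracketIdeal I).toSubmodule ≤ P := by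
  refine bracketIdeal_le fun x i hi => ?_
  rw [AlternatingMap.map_eq_removeNth _ x i]
  exact zsmul_mem (S := Submodule K L) (h _ hi _) _

end jacobi

/-! ### Universal property of the free algebra -/

namespace FreeNLie

section lift

variable {K : Type*} [Field K] {n : ℕ} {X : Type*}

/-- A subspace which contains the generators and is closed under brackets is everything. -/
theorem mem_of_closed (P : Submodule K (FreeNLie K n X)) (hof : ∀ x, of x ∈ P)
    (hbr : ∀ v : Fin n → FreeNLie K n X, (∀ i, v i ∈ P) → nbr K n v ∈ P)
    (a : FreeNLie K n X) : a ∈ P := by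
  obtain ⟨a, rfl⟩ := mk_surj a
  induction a with
  | of x => exact hof x
  | zero => exact P.zero_mem
  | add a b ha hb => exact P.add_mem ha hb
  | smul c a ha => exact P.smul_mem c ha
  | bracket v hv =>
    rw [← br_mk]
    exact hbr _ hv

theorem mem_span_of_sup_bracketIdeal [NeZero n] (a : FreeNLie K n X) :
    a ∈ Submodule.span K (Set.range (of : X → FreeNLie K n X)) ⊔
      (bracketIdeal (topIdeal K n (FreeNLie K n X))).toSubmodule := by
  refine mem_of_closed _
    (fun x => Submodule.mem_sup_left (Submodule.subset_span (Set.mem_range_self x))) (fun v _ => Submodule.mem_sup_right ?_) a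
  exact nbr_mem_bracketIdeal (topIdeal K n (FreeNLie K n X)) 0 (show _ ∈ ⊤ from trivial)

variable {L : Type*} [AddCommGroup L] [Module K L] [NLieAlgebra K n L]

/-- The value of a formal expression in an `n`-Lie algebra. -/
def eval (φ : X → L) : PreNLie K n X → L
  | .of x => φ x
  | .zero => 0
  | .add a b => eval φ a + eval φ b
  | .smul c a => c • eval φ a
  | .bracket v => nbr K n fun i => eval φ (v i)

theorem eval_sum (φ : X → L) {k : ℕ} (f : Fin k → PreNLie K n X) :
    eval φ (PreNLie.sum f) = ∑ i, eval φ (f i) := by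
  have h : ∀ l : List (PreNLie K n X),
      eval φ (l.foldr PreNLie.add PreNLie.zero) = (l.map (eval φ)).sum := by
    intro l
    induction l with
    | nil => rfl
    | cons a l ih => simp [eval, ih]
  rw [PreNLie.sum, h, List.map_ofFn, List.sum_ofFn]
  rfl

theorem eval_update (φ : X → L) (v : Fin n → PreNLie K n X) (i : Fin n) (a : PreNLie K n X) :
    (fun k => eval φ (Function.update v i a k)) =
      Function.update (fun k => eval φ (v k)) i (eval φ a) := by
  funext k
  by_cases hk : k = i
  · subst hk; simp
  · simp [hk]

theorem eval_eq (φ : X → L) {a b : PreNLie K n X} (h : NLieRel K n X a b) :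
    eval φ a = eval φ b := by
  induction h with
  | refl a => rfl
  | symm _ ih => exact ih.symm
  | trans _ _ ih ih' => exact ih.trans ih'
  | add_congr _ _ ih ih' => simp only [eval, ih, ih']
  | smul_congr c _ ih => simp only [eval, ih]
  | bracket_congr _ ih => simp only [eval, ih]
  | add_assoc a b c => exact add_assoc _ _ _
  | add_comm a b => exact add_comm _ _
  | zero_add a => exact zero_add _
  | zero_smul a => exact zero_smul K _
  | one_smul a => exact one_smul K _
  | mul_smul c d a => exact mul_smul _ _ _
  | smul_add c a b => exact smul_add _ _ _
  | add_smul c d a => exact add_smul _ _ _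
  | bracket_add v i a b => simp only [eval, eval_update, AlternatingMap.map_update_add]
  | bracket_smul v i c a => simp only [eval, eval_update, AlternatingMap.map_update_smul]
  | bracket_alt v i j hij hv =>
    exact AlternatingMap.map_eq_zero_of_eq _ _ (congrArg (eval φ) hv) hij
  | jacobi j x y =>
    simp only [eval, eval_sum, eval_update]
    exact NLieAlgebra.jacobi j _ _

/-- The universal property of the free `n`-Lie algebra. -/
def lift (φ : X → L) : NLieHom K n (FreeNLie K n X) L where
  toLinearMap :=
    { toFun := Quotient.lift (eval φ) fun _ _ h => eval_eq φ h
      map_add' := by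
        intro a b
        obtain ⟨a, rfl⟩ := mk_surj a
        obtain ⟨b, rfl⟩ := mk_surj b
        rfl
      map_smul' := by
        intro c a
        obtain ⟨a, rfl⟩ := mk_surj a
        rfl }
  map_bracket := by
    intro v
    obtain ⟨w, rfl⟩ := exists_rep_fun v
    exact congrArg (Quotient.lift (eval φ) fun _ _ h => eval_eq φ h) (br_mk w)

theorem lift_of (φ : X → L) (x : X) : (lift (n := n) (K := K) φ).toLinearMap (of x) = φ x := rfl

theorem hom_ext {f g : NLieHom K n (FreeNLie K n X) L}
    (h : ∀ x, f.toLinearMap (of x) = g.toLinearMap (of x)) (a : FreeNLie K n X) :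
    f.toLinearMap a = g.toLinearMap a := by
  refine mem_of_closed (LinearMap.eqLocus f.toLinearMap g.toLinearMap) h (fun v hv => ?_) a
  rw [LinearMap.mem_eqLocus, f.map_bracket, g.map_bracket]
  exact congrArg _ (funext hv)

end lift

end FreeNLie

/-! ### `F³ ⊆ [R,F,…,F]` for Heisenberg quotients -/

section heisenberg

variable {K : Type*} [Field K] {p : ℕ}

/-- The rigidity behind the vanishing of `F³` modulo `[R, F, …, F]`: if
`ω(x) τ(y) = ∑ᵢ ± ω(xᵢ, y) τ(x̂ᵢ)` and `τ(y) ≠ 0`, then the vanishing of `ω(v, y)` and of all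
`τ(v, ŷᵢ)` puts `v` into the radical of `ω`. -/
theorem alternating_radical_of_relation {V : Type*} [AddCommGroup V] [Module K V]
    (ω : V [⋀^Fin (p + 1)]→ₗ[K] K) (τ : V [⋀^Fin p]→ₗ[K] K)
    (h : ∀ (x : Fin (p + 1) → V) (y : Fin p → V), ω x * τ y =
      ∑ i : Fin (p + 1), (-1) ^ (i : ℕ) * (ω (Matrix.vecCons (x i) y) * τ (i.removeNth x)))
    {y₀ : Fin p → V} (hy₀ : τ y₀ ≠ 0) {v : V} (hω : ω (Matrix.vecCons v y₀) = 0)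
    (hτ : ∀ i, τ (Function.update y₀ i v) = 0) (y : Fin p → V) :
    ω (Matrix.vecCons v y) = 0 := by
  -- With `x = (v,y₀)` the term `i = 0` is `ω(v,y) τ(y₀)`; in all other terms `v` is an argument of
  -- `τ` next to entries of `y₀`.
  have h1 : ω (Matrix.vecCons v y₀) * τ y = _ := h (Matrix.vecCons v y₀) y
  rw [hω, zero_mul, Fin.sum_univ_succ] at h1
  have h2 : ∀ i : Fin p, τ (i.succ.removeNth (Matrix.vecCons v y₀)) = 0 := by
    intro i
    cases p with
    | zero => exact i.elim0
    | succ q =>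
      have h3 := hτ i
      rw [AlternatingMap.map_update_eq_removeNth] at h3
      rw [removeNth_succ_vecCons]
      simpa using h3
  simp only [h2, mul_zero, Finset.sum_const_zero, add_zero] at h1
  simpa [removeNth_zero_vecCons, hy₀] using h1

variable {L : Type*} [AddCommGroup L] [Module K L] [NLieAlgebra K (p + 1) L]
  {F : Type*} [AddCommGroup F] [Module K F] [NLieAlgebra K (p + 1) F]

/-- Modulo `R` every bracket is a multiple of a single `u`, so a functional on `F/[R,F,…,F]`
evaluates double brackets as products `ω(x) τ(y)`. Rigidity of such products bounds `dim L` by `p +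
2`. -/
theorem lowerCentral_three_le_bracketIdeal_ker (hL : IsHeisenberg K (p + 1) L)
    (hdim : p + 2 < Module.finrank K L) (π : NLieHom K (p + 1) F L)
    (hπ : Function.Surjective π.toLinearMap) :
    (lowerCentral K (p + 1) F 3).toSubmodule ≤ (bracketIdeal π.ker).toSubmodule := by
  obtain ⟨hZ, h1⟩ := hL
  refine bracketIdeal_le_of_vecCons fun u hu y₀ => ?_
  by_contra hy₀
  obtain ⟨lam, hlam0, hlam⟩ := Submodule.exists_le_ker_of_notMem hy₀
  have hπ2 : ∀ a ∈ (lowerCentral K (p + 1) F 2).toSubmodule,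
      π.toLinearMap a ∈ (lowerCentral K (p + 1) L 2).toSubmodule :=
    π.map_gammaSucc (I := topIdeal K (p + 1) F) (J := topIdeal K (p + 1) L) (fun _ _ => trivial) 1
  have hu0 : π.toLinearMap u ≠ 0 := fun h0 =>
    hy₀ (nbr_mem_bracketIdeal π.ker 0 (LinearMap.mem_ker.2 h0))
  obtain ⟨θ, hθ⟩ : ∃ θ : L →ₗ[K] K, θ (π.toLinearMap u) = 1 :=
    Module.Projective.exists_dual_eq_one K hu0
  -- `L²` is the line through `π u`, and `θ` is its coordinate.
  have hgen : ∀ w ∈ (lowerCentral K (p + 1) L 2).toSubmodule, w = θ w • π.toLinearMap u := by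
    intro w hw
    obtain ⟨c, hc⟩ := (finrank_eq_one_iff_of_nonzero' (⟨π.toLinearMap u, hπ2 u hu⟩ :
      (lowerCentral K (p + 1) L 2).toSubmodule) (by simpa using hu0)).1 h1 ⟨w, hw⟩
    have hc' : c • π.toLinearMap u = w := congrArg Subtype.val hc
    rw [← hc', map_smul, hθ, smul_eq_mul, mul_one]
  let ω : F [⋀^Fin (p + 1)]→ₗ[K] K := (θ ∘ₗ π.toLinearMap).compAlternatingMap (nbr K (p + 1))
  let τ : F [⋀^Fin p]→ₗ[K] K := lam.compAlternatingMap ((nbr K (p + 1)).curryLeft u)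
  -- `[x] - ω(x) u` lies in `R`, and `lam` kills `[R,F,…,F]`.
  have hred : ∀ (x : Fin (p + 1) → F) (y : Fin p → F),
      lam (nbr K (p + 1) (Matrix.vecCons (nbr K (p + 1) x) y)) = ω x * τ y := by
    intro x y
    have hmem : nbr K (p + 1) x - ω x • u ∈ π.ker.toSubmodule := by
      refine LinearMap.mem_ker.2 ?_
      rw [map_sub, map_smul, sub_eq_zero]
      exact hgen _ (hπ2 _ (nbr_mem_bracketIdeal (topIdeal K (p + 1) F) 0 (show _ ∈ ⊤ from trivial)))
    have h2 : lam (nbr K (p + 1) (Matrix.vecCons (nbr K (p + 1) x - ω x • u) y)) = 0 :=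
      hlam (nbr_mem_bracketIdeal π.ker 0 hmem)
    have h3 : nbr K (p + 1) (Matrix.vecCons (nbr K (p + 1) x) y) =
        nbr K (p + 1) (Matrix.vecCons (nbr K (p + 1) x - ω x • u) y) +
          ω x • nbr K (p + 1) (Matrix.vecCons u y) := by
      rw [← AlternatingMap.map_vecCons_smul, ← AlternatingMap.map_vecCons_add, sub_add_cancel]
    rw [h3, map_add, h2, zero_add, map_smul]
    rfl
  have hrel : ∀ (x : Fin (p + 1) → F) (y : Fin p → F), ω x * τ y =
      ∑ i : Fin (p + 1), (-1) ^ (i : ℕ) * (ω (Matrix.vecCons (x i) y) * τ (i.removeNth x)) := by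
    intro x y
    rw [← hred, nbr_vecCons_nbr, map_sum]
    refine Finset.sum_congr rfl fun i _ => ?_
    rw [map_zsmul, hred, zsmul_eq_mul]
    simp
  obtain ⟨s, hs⟩ := π.toLinearMap.exists_rightInverse_of_surjective (LinearMap.range_eq_top.2 hπ)
  have hs' : ∀ v, π.toLinearMap (s v) = v := fun v => LinearMap.congr_fun hs v
  -- The `1 + p` linear conditions on `v` from `alternating_radical_of_relation`, pulled back to `L`
  -- along a linear section of `π`.
  let Φ : L →ₗ[K] K × (Fin p → K) :=
    ((ω.toMultilinearMap.toLinearMap (Matrix.vecCons 0 y₀) 0) ∘ₗ s).prod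
      (LinearMap.pi fun i => (τ.toMultilinearMap.toLinearMap y₀ i) ∘ₗ s)
  have hker : LinearMap.ker Φ ≤ (nCenter K (p + 1) L).toSubmodule := by
    intro v hv x i
    have hv' : ω (Function.update (Matrix.vecCons 0 y₀) 0 (s v)) = 0 :=
      congrArg Prod.fst (LinearMap.mem_ker.1 hv)
    rw [update_vecCons_zero] at hv'
    have hrad := alternating_radical_of_relation ω τ hrel hlam0 hv'
      (fun j => congrFun (congrArg Prod.snd (LinearMap.mem_ker.1 hv)) j)
    rw [AlternatingMap.map_update_eq_removeNth]
    have h2 : nbr K (p + 1) (Matrix.vecCons v (i.removeNth x)) =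
        π.toLinearMap (nbr K (p + 1) (Matrix.vecCons (s v) (s ∘ i.removeNth x))) := by
      rw [π.map_bracket]
      congr 1
      funext j
      refine Fin.cases ?_ (fun k => ?_) j
      · exact (hs' v).symm
      · exact (hs' _).symm
    have h3 := hrad (s ∘ i.removeNth x)
    have h4 : θ (nbr K (p + 1) (Matrix.vecCons v (i.removeNth x))) = 0 := by
      rw [h2]
      exact h3
    rw [hgen (nbr K (p + 1) (Matrix.vecCons v (i.removeNth x)))
      (nbr_mem_bracketIdeal (topIdeal K (p + 1) L) 0 (show _ ∈ ⊤ from trivial)), h4, zero_smul,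
      smul_zero]
  have hfin : Module.Finite K L := Module.finite_of_finrank_pos (by omega)
  -- The kernel lies in the center, which is `L²` and has dimension one; the range has dimension at
  -- most `p + 1`.
  have hr := Φ.finrank_range_add_finrank_ker
  have hr1 : Module.finrank K (LinearMap.range Φ) ≤ p + 1 := by
    refine (Submodule.finrank_le _).trans ?_
    simp [add_comm]
  have hr2 : Module.finrank K (LinearMap.ker Φ) ≤ 1 := by
    rw [← h1, hZ]
    exact Submodule.finrank_mono hker
  omega

end heisenberg

/-! ### Identification of the multipliers -/

section multiplier

variable {K : Type*} [Field K] {n : ℕ}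

/-- `l_d^n(w)` is the dimension of this space. -/
abbrev lowerCentralQuot (K : Type*) [Field K] (n d w : ℕ) : Type _ :=
  (lowerCentral K n (FreeNLie K n (Fin d)) w).toSubmodule ⧸
    (lowerCentral K n (FreeNLie K n (Fin d)) (w + 1)).toSubmodule.submoduleOf
      (lowerCentral K n (FreeNLie K n (Fin d)) w).toSubmodule

section heisenbergKernel

variable {L : Type*} [AddCommGroup L] [Module K L] [NLieAlgebra K n L]
  {F : Type*} [AddCommGroup F] [Module K F] [NLieAlgebra K n F]

theorem mem_lowerCentral_two [NeZero n] (x : Fin n → L) :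
    nbr K n x ∈ (lowerCentral K n L 2).toSubmodule :=
  nbr_mem_bracketIdeal (topIdeal K n L) 0 (show _ ∈ ⊤ from trivial)

theorem IsHeisenberg.lowerCentral_three_eq_bot (hL : IsHeisenberg K n L) :
    (lowerCentral K n L 3).toSubmodule = ⊥ := by
  rw [eq_bot_iff]
  refine bracketIdeal_le fun x i hi => ?_
  have hi' : x i ∈ (nCenter K n L).toSubmodule := by
    rw [← hL.1]
    exact hi
  simpa using hi' x i

theorem NLieHom.map_lowerCentral (f : NLieHom K n F L) (c : ℕ) :
    ∀ a ∈ (lowerCentral K n F c).toSubmodule,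
      f.toLinearMap a ∈ (lowerCentral K n L c).toSubmodule :=
  f.map_gammaSucc (I := topIdeal K n F) (J := topIdeal K n L) (fun _ _ => trivial) (c - 1)

theorem IsHeisenberg.lowerCentral_three_le_ker (hL : IsHeisenberg K n L) (π : NLieHom K n F L) :
    (lowerCentral K n F 3).toSubmodule ≤ π.ker.toSubmodule := by
  intro a ha
  have h := π.map_lowerCentral 3 a ha
  rw [hL.lowerCentral_three_eq_bot] at h
  exact LinearMap.mem_ker.2 ((Submodule.mem_bot K).1 h)

theorem NLieHom.lowerCentral_two_le_map (π : NLieHom K n F L)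
    (hπ : Function.Surjective π.toLinearMap) :
    (lowerCentral K n L 2).toSubmodule ≤
      (lowerCentral K n F 2).toSubmodule.map π.toLinearMap := by
  refine bracketIdeal_le fun x i _ => ?_
  choose y hy using fun j => hπ (x j)
  refine ⟨nbr K n y, nbr_mem_bracketIdeal (topIdeal K n F) i (show _ ∈ ⊤ from trivial), ?_⟩
  rw [π.map_bracket]
  exact congrArg _ (funext hy)

theorem mem_ker_quotHom_comp {π : NLieHom K n F L} {I : NLieIdeal K n L} {a : F} :
    a ∈ ((quotHom I).comp π).ker.toSubmodule ↔ π.toLinearMap a ∈ I.toSubmodule :=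
  Submodule.Quotient.mk_eq_zero _

/-- If `F³ ⊆ [R, F, …, F]`, then `[R + F², F, …, F] = [R, F, …, F]`. -/
theorem bracketIdeal_ker_quotHom_comp {π : NLieHom K n F L}
    (hπ : Function.Surjective π.toLinearMap)
    (h3 : (lowerCentral K n F 3).toSubmodule ≤ (bracketIdeal π.ker).toSubmodule) :
    bracketIdeal ((quotHom (lowerCentral K n L 2)).comp π).ker = bracketIdeal π.ker := by
  refine NLieIdeal.ext (le_antisymm (bracketIdeal_le fun x i hi => ?_) (bracketIdeal_mono ?_))
  -- `F²` maps onto `L²`, so the entry `x i` splits as an element of `R` plus `f ∈ F²`.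
  · obtain ⟨f, hf, hfx⟩ := π.lowerCentral_two_le_map hπ (mem_ker_quotHom_comp.1 hi)
    have h1 : nbr K n (Function.update x i (x i - f)) ∈ (bracketIdeal π.ker).toSubmodule := by
      refine nbr_mem_bracketIdeal _ i (LinearMap.mem_ker.2 ?_)
      rw [Function.update_self, map_sub, hfx, sub_self]
    have h2 : nbr K n (Function.update x i f) ∈ (bracketIdeal π.ker).toSubmodule := by
      refine h3 (nbr_mem_bracketIdeal (lowerCentral K n F 2) i ?_)
      rwa [Function.update_self]
    have h := Submodule.add_mem _ h1 h2
    rwa [← AlternatingMap.map_update_add, sub_add_cancel, Function.update_eq_self] at h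
  · intro a ha
    refine mem_ker_quotHom_comp.2 ?_
    rw [LinearMap.mem_ker.1 ha]
    exact Submodule.zero_mem _

end heisenbergKernel

section abelianMultiplier

variable [NeZero n]
  {L : Type*} [AddCommGroup L] [Module K L] [NLieAlgebra K n L]
  {L' : Type*} [AddCommGroup L'] [Module K L'] [NLieAlgebra K n L']
  {F : Type*} [AddCommGroup F] [Module K F] [NLieAlgebra K n F]

/-- Representatives can be chosen in `F³`, so their bracket lies in `F⁴`. -/
theorem nbr_nilMultiplier_two_eq_zero (π : NLieHom K n F L)
    (h4 : (lowerCentral K n F 4).toSubmodule ≤ (gammaSucc π.ker 2).toSubmodule)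
    (x : Fin n → (nilMultiplier 2 π).toSubmodule) : nbr K n x = 0 := by
  apply Subtype.ext
  choose w hw hwx using fun i => (x i).2
  change nbr K n (fun i => (x i : F ⧸ (gammaSucc π.ker 2).toSubmodule)) = 0
  rw [← funext hwx]
  refine (quotBracket_mk _ w).trans ((Submodule.Quotient.mk_eq_zero _).2 (h4 ?_))
  exact nbr_mem_bracketIdeal (lowerCentral K n F 3) 0 (hw 0).2

/-- If the multipliers of two quotients of `F` are formed by the same subspaces of `F` and are
abelian, then the identity of `F` induces an isomorphism between them. -/
theorem exists_nilMultiplier_equiv (π : NLieHom K n F L) (π' : NLieHom K n F L')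
    (hγ : (gammaSucc π.ker 2).toSubmodule = (gammaSucc π'.ker 2).toSubmodule)
    (h3 : (lowerCentral K n F 3).toSubmodule ≤ π.ker.toSubmodule)
    (h3' : (lowerCentral K n F 3).toSubmodule ≤ π'.ker.toSubmodule)
    (h4 : (lowerCentral K n F 4).toSubmodule ≤ (gammaSucc π.ker 2).toSubmodule) :
    ∃ e : NLieEquiv K n (nilMultiplier 2 π).toSubmodule (nilMultiplier 2 π').toSubmodule,
      ∀ (f : F) (x : (nilMultiplier 2 π).toSubmodule),
        (x : F ⧸ (gammaSucc π.ker 2).toSubmodule) = Submodule.Quotient.mk f →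
        (e.toLinearEquiv x : F ⧸ (gammaSucc π'.ker 2).toSubmodule) = Submodule.Quotient.mk f := by
  have hmap : (nilMultiplier 2 π).toSubmodule.map
      (Submodule.quotEquivOfEq _ _ hγ : _ →ₗ[K] _) = (nilMultiplier 2 π').toSubmodule := by
    change ((π.ker.toSubmodule ⊓ (lowerCentral K n F 3).toSubmodule).map
      (gammaSucc π.ker 2).toSubmodule.mkQ).map _ =
      (π'.ker.toSubmodule ⊓ (lowerCentral K n F 3).toSubmodule).map
        (gammaSucc π'.ker 2).toSubmodule.mkQ
    rw [inf_eq_right.2 h3, inf_eq_right.2 h3', ← Submodule.map_comp]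
    rfl
  refine ⟨⟨LinearEquiv.ofSubmodules (Submodule.quotEquivOfEq _ _ hγ) _ _ hmap, fun x => ?_⟩, ?_⟩
  · rw [nbr_nilMultiplier_two_eq_zero π h4, map_zero,
      nbr_nilMultiplier_two_eq_zero π' (hγ ▸ h4)]
  · intro f x hx
    change Submodule.quotEquivOfEq _ _ hγ (x : F ⧸ (gammaSucc π.ker 2).toSubmodule) = _
    rw [hx]
    rfl

end abelianMultiplier

/-! ### Comparison with the free algebra on `d` letters -/

section comparison

variable [NeZero n]

variable {A : Type*} [AddCommGroup A] [Module K A] [NLieAlgebra K n A]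
  {L : Type*} [AddCommGroup L] [Module K L] [NLieAlgebra K n L] {X : Type*} {d : ℕ}

/-- Modulo `F_d²` an element is a combination of generators. The abelian target kills `F_d²`, and
independence of `b` recovers the coefficients. -/
theorem ker_lift_le_of_linearIndependent (hA : ∀ x : Fin n → A, nbr K n x = 0)
    {b : Fin d → A} (hb : LinearIndependent K b) :
    (FreeNLie.lift (n := n) (K := K) b).ker.toSubmodule ≤
      (lowerCentral K n (FreeNLie K n (Fin d)) 2).toSubmodule := by
  intro a ha
  obtain ⟨s, hs, f, hf, rfl⟩ := Submodule.mem_sup.1 (FreeNLie.mem_span_of_sup_bracketIdeal a)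
  obtain ⟨c, rfl⟩ := (Submodule.mem_span_range_iff_exists_fun K).1 hs
  have hf0 : (FreeNLie.lift (n := n) (K := K) b).toLinearMap f = 0 := by
    refine LinearMap.mem_ker.1 (bracketIdeal_le (P := LinearMap.ker _) (fun x i _ => ?_) hf)
    rw [LinearMap.mem_ker, NLieHom.map_bracket, hA]
  have h := LinearMap.mem_ker.1 ha
  rw [map_add, hf0, add_zero, map_sum] at h
  simp only [map_smul, FreeNLie.lift_of] at h
  have hc := Fintype.linearIndependent_iff.1 hb c h
  simp only [hc, zero_smul, Finset.sum_const_zero, zero_add]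
  exact hf

/-- `F_d³/F_d⁴` is the `2`-nilpotent multiplier of `L = F/R` whenever `γ₃(R, F, …, F)` agrees with
`γ₃(S, F, …, F)` for an abelian quotient `A = F/S` of dimension `d`, and `F³ ⊆ R`. -/
theorem exists_lowerCentralQuot_equiv (hA : ∀ x : Fin n → A, nbr K n x = 0)
    (b : Module.Basis (Fin d) K A) (q : NLieHom K n (FreeNLie K n X) A)
    (hq : Function.Surjective q.toLinearMap)
    (π : NLieHom K n (FreeNLie K n X) L)
    (hγ : (gammaSucc π.ker 2).toSubmodule = (gammaSucc q.ker 2).toSubmodule)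
    (h3 : (lowerCentral K n (FreeNLie K n X) 3).toSubmodule ≤ π.ker.toSubmodule) :
    Nonempty (lowerCentralQuot K n d 3 ≃ₗ[K] (nilMultiplier 2 π).toSubmodule) := by
  choose g hg using fun i => hq (b i)
  let ψ : NLieHom K n (FreeNLie K n (Fin d)) (FreeNLie K n X) := FreeNLie.lift g
  let ρ : NLieHom K n (FreeNLie K n (Fin d)) A := FreeNLie.lift b
  -- Each generator goes to the linear lift of its image in `A`. Thus `φ` and `ψ` both cover the
  -- identity of `A` and are mutually inverse modulo `ker ρ ⊆ F_d²` and `ker q`.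
  let φ : NLieHom K n (FreeNLie K n X) (FreeNLie K n (Fin d)) :=
    FreeNLie.lift fun x => ∑ i, b.repr (q.toLinearMap (FreeNLie.of x)) i • FreeNLie.of i
  have hqψ : ∀ a, q.toLinearMap (ψ.toLinearMap a) = ρ.toLinearMap a :=
    FreeNLie.hom_ext (f := q.comp ψ) (g := ρ) hg
  have hρφ : ∀ a, ρ.toLinearMap (φ.toLinearMap a) = q.toLinearMap a := by
    refine FreeNLie.hom_ext (f := ρ.comp φ) (g := q) fun x => ?_
    change ρ.toLinearMap (∑ i, b.repr (q.toLinearMap (FreeNLie.of x)) i • FreeNLie.of i) = _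
    rw [map_sum]
    simp only [map_smul]
    exact b.sum_repr _
  have hρ : ∀ a, ρ.toLinearMap a = 0 →
      a ∈ (lowerCentral K n (FreeNLie K n (Fin d)) 2).toSubmodule := fun a ha =>
    ker_lift_le_of_linearIndependent hA b.linearIndependent (LinearMap.mem_ker.2 ha)
  -- `φ` sends `ker q` into `F_d²`, and `γ₃(F_d²,F_d,…,F_d)` is `F_d⁴` by definition.
  have hφ4 : ∀ a ∈ (gammaSucc q.ker 2).toSubmodule,
      φ.toLinearMap a ∈ (lowerCentral K n (FreeNLie K n (Fin d)) 4).toSubmodule :=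
    φ.map_gammaSucc (J := lowerCentral K n (FreeNLie K n (Fin d)) 2)
      (fun a ha => hρ _ ((hρφ a).trans (LinearMap.mem_ker.1 ha))) 2
  have hψ4 : ∀ a ∈ (lowerCentral K n (FreeNLie K n (Fin d)) 4).toSubmodule,
      ψ.toLinearMap a ∈ (gammaSucc q.ker 2).toSubmodule := by
    refine ψ.map_gammaSucc (I := lowerCentral K n (FreeNLie K n (Fin d)) 2) (fun a ha => ?_) 2
    refine LinearMap.mem_ker.2 ?_
    have h := (q.comp ψ).map_lowerCentral 2 a ha
    refine (Submodule.mem_bot K).1 (bracketIdeal_le (P := ⊥) (fun x i _ => ?_) h)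
    rw [hA]
    exact Submodule.zero_mem _
  have hψφ : ∀ a ∈ (lowerCentral K n (FreeNLie K n X) 3).toSubmodule,
      ψ.toLinearMap (φ.toLinearMap a) - a ∈ (gammaSucc q.ker 2).toSubmodule := by
    refine (ψ.comp φ).sub_mem_gammaSucc_two ⟨LinearMap.id, fun _ => rfl⟩ q.ker fun a => ?_
    refine LinearMap.mem_ker.2 ?_
    rw [map_sub, sub_eq_zero]
    exact (hqψ _).trans (hρφ a)
  have hφψ : ∀ a ∈ (lowerCentral K n (FreeNLie K n (Fin d)) 3).toSubmodule,
      φ.toLinearMap (ψ.toLinearMap a) - a ∈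
        (lowerCentral K n (FreeNLie K n (Fin d)) 4).toSubmodule := by
    refine (φ.comp ψ).sub_mem_gammaSucc_two ⟨LinearMap.id, fun _ => rfl⟩
      (lowerCentral K n (FreeNLie K n (Fin d)) 2) fun a => hρ _ ?_
    rw [map_sub, sub_eq_zero]
    exact (hρφ _).trans (hqψ a)
  let Θ : (lowerCentral K n (FreeNLie K n (Fin d)) 3).toSubmodule →ₗ[K]
      (nilMultiplier 2 π).toSubmodule :=
    (((gammaSucc π.ker 2).toSubmodule.mkQ ∘ₗ ψ.toLinearMap) ∘ₗ Submodule.subtype _).codRestrict _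
      fun a => ⟨ψ.toLinearMap a, ⟨h3 (ψ.map_lowerCentral 3 _ a.2), ψ.map_lowerCentral 3 _ a.2⟩, rfl⟩
  have hΘ0 : ∀ a, Θ a = 0 ↔ ψ.toLinearMap a ∈ (gammaSucc π.ker 2).toSubmodule := fun a =>
    Subtype.ext_iff.trans (Submodule.Quotient.mk_eq_zero _)
  have hker : LinearMap.ker Θ =
      (lowerCentral K n (FreeNLie K n (Fin d)) 4).toSubmodule.submoduleOf
        (lowerCentral K n (FreeNLie K n (Fin d)) 3).toSubmodule := by
    ext a
    rw [LinearMap.mem_ker, hΘ0, hγ, Submodule.submoduleOf, Submodule.mem_comap]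
    -- If `ψ a` is trivial then `φ (ψ a) ∈ F_d⁴`, and `a` differs from it by an element of `F_d⁴`.
    refine ⟨fun h => ?_, hψ4 a⟩
    have h1 := Submodule.sub_mem _ (hφ4 _ h) (hφψ a a.2)
    rwa [sub_sub_cancel] at h1
  have hsurj : Function.Surjective Θ := by
    rintro ⟨_, a, ⟨-, ha⟩, rfl⟩
    refine ⟨⟨φ.toLinearMap a, φ.map_lowerCentral 3 a ha⟩, Subtype.ext ?_⟩
    refine (Submodule.Quotient.eq _).2 ?_
    rw [hγ]
    exact hψφ a ha
  exact ⟨(Submodule.quotEquivOfEq _ _ hker.symm).trans (Θ.quotKerEquivOfSurjective hsurj)⟩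

end comparison

end multiplier

/-! ### Doubly alternating forms and the `sl₂` relation -/

section biforms

variable {K : Type*} [Field K] {V : Type*} [AddCommGroup V] [Module K V]

/-- Forms which are alternating in a first group of `a` and in a second group of `b` variables. -/
abbrev BiForm (K V : Type*) [Field K] [AddCommGroup V] [Module K V] (a b : ℕ) : Type _ :=
  V [⋀^Fin a]→ₗ[K] V [⋀^Fin b]→ₗ[K] K

namespace BiForm

protected theorem add_right_cancel {a b : ℕ} {f g h : BiForm K V a b} (H : f + h = g + h) :
    f = g := by
  ext x y
  exact add_right_cancel (DFunLike.congr_fun (DFunLike.congr_fun H x) y)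

/-- Interchange of the two groups of variables. -/
def flip {a b : ℕ} (f : BiForm K V a b) : BiForm K V b a where
  toFun y :=
    { toFun := fun x => f x y
      map_update_add' := fun x i u v => by rw [f.map_update_add]; rfl
      map_update_smul' := fun x i c u => by rw [f.map_update_smul]; rfl
      map_eq_zero_of_eq' := fun x i j h hij => by rw [f.map_eq_zero_of_eq x h hij]; rfl }
  map_update_add' y i u v := AlternatingMap.ext fun x => (f x).map_update_add y i u v
  map_update_smul' y i c u := AlternatingMap.ext fun x => (f x).map_update_smul y i c u
  map_eq_zero_of_eq' y i j h hij := AlternatingMap.ext fun x => (f x).map_eq_zero_of_eq y h hij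

@[simp] theorem flip_apply {a b : ℕ} (f : BiForm K V a b) (x : Fin a → V) (y : Fin b → V) :
    f.flip y x = f x y := rfl

theorem flip_flip {a b : ℕ} (f : BiForm K V a b) : f.flip.flip = f := rfl

/-- `flip` as a linear map. -/
def flipₗ (a b : ℕ) : BiForm K V a b →ₗ[K] BiForm K V b a where
  toFun := flip
  map_add' _ _ := rfl
  map_smul' _ _ := rfl

/-- Antisymmetrization which moves a variable from the first group to the second:
`(E f)(x; y₀, …, y_b) = ∑ᵢ (-1)ⁱ f(yᵢ, x; ŷᵢ)`. -/
def lower (a b : ℕ) : BiForm K V (a + 1) b →ₗ[K] BiForm K V a (b + 1) where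
  toFun f := LinearMap.compAlternatingMap
      (AlternatingMap.alternatizeUncurryFinLM (R := K) (M := V) (N := K) (n := b))
      { toFun := fun x =>
          { toFun := fun v => f (Matrix.vecCons v x)
            map_add' := fun u v => f.map_vecCons_add x u v
            map_smul' := fun c u => f.map_vecCons_smul x c u }
        map_update_add' := fun x i u w => LinearMap.ext fun v =>
          (f.curryLeft v).map_update_add x i u w
        map_update_smul' := fun x i c u => LinearMap.ext fun v =>
          (f.curryLeft v).map_update_smul x i c u
        map_eq_zero_of_eq' := fun x i j h hij => LinearMap.ext fun v =>
          (f.curryLeft v).map_eq_zero_of_eq x h hij }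
  map_add' f g := by
    ext x y
    simp [AlternatingMap.alternatizeUncurryFin_apply, Finset.sum_add_distrib]
  map_smul' c f := by
    ext x y
    simp [AlternatingMap.alternatizeUncurryFin_apply, Finset.mul_sum, mul_left_comm]

theorem lower_apply {a b : ℕ} (f : BiForm K V (a + 1) b) (x : Fin a → V) (y : Fin (b + 1) → V) :
    lower a b f x y = ∑ i : Fin (b + 1),
      (-1) ^ (i : ℕ) * f (Matrix.vecCons (y i) x) (i.removeNth y) := by
  refine (AlternatingMap.alternatizeUncurryFin_apply _ _).trans ?_
  simp

/-- Antisymmetrization which moves a variable from the second group to the first. -/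
def raise (a b : ℕ) : BiForm K V a (b + 1) →ₗ[K] BiForm K V (a + 1) b :=
  flipₗ b (a + 1) ∘ₗ lower b a ∘ₗ flipₗ a (b + 1)

theorem raise_apply {a b : ℕ} (f : BiForm K V a (b + 1)) (x : Fin (a + 1) → V) (y : Fin b → V) :
    raise a b f x y = ∑ i : Fin (a + 1),
      (-1) ^ (i : ℕ) * f (i.removeNth x) (Matrix.vecCons (x i) y) :=
  lower_apply f.flip y x

theorem flip_lower {a b : ℕ} (f : BiForm K V (a + 1) b) :
    (lower a b f).flip = raise b a f.flip := rfl

theorem flip_raise {a b : ℕ} (f : BiForm K V a (b + 1)) :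
    (raise a b f).flip = lower b a f.flip := rfl

theorem neg_one_pow_mul_removeNth {b : ℕ} (g : V [⋀^Fin (b + 1)]→ₗ[K] K) (y : Fin (b + 1) → V)
    (i : Fin (b + 1)) :
    (-1) ^ (i : ℕ) * g (Matrix.vecCons (y i) (i.removeNth y)) = g y := by
  rw [g.map_eq_removeNth y i]
  simp

/-- The commutator of the two antisymmetrizations. -/
theorem lower_raise {a b : ℕ} (f : BiForm K V (a + 1) (b + 1)) :
    lower (a + 1) b (raise (a + 1) b f) + ((a + 1 : ℕ) : K) • f =
      raise a (b + 1) (lower a (b + 1) f) + ((b + 1 : ℕ) : K) • f := by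
  -- In either order of composition, the terms that move a variable and then move it back give a
  -- multiple of `f`; the remaining double sum is the same for both orders.
  have h1 : ∀ x y, lower (a + 1) b (raise (a + 1) b f) x y = ((b + 1 : ℕ) : K) * f x y +
      ∑ j : Fin (b + 1), ∑ i : Fin (a + 1), (-1) ^ (j : ℕ) * ((-1) ^ ((i : ℕ) + 1) *
        f (Matrix.vecCons (y j) (i.removeNth x)) (Matrix.vecCons (x i) (j.removeNth y))) := by
    intro x y
    simp only [lower_apply, raise_apply, Fin.sum_univ_succ (n := a + 1), mul_add,
      Finset.sum_add_distrib, Finset.mul_sum]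
    congr 1
    · simp [neg_one_pow_mul_removeNth]
    · simp [removeNth_succ_vecCons]
  have h2 : ∀ x y, raise a (b + 1) (lower a (b + 1) f) x y = ((a + 1 : ℕ) : K) * f x y +
      ∑ i : Fin (a + 1), ∑ j : Fin (b + 1), (-1) ^ (i : ℕ) * ((-1) ^ ((j : ℕ) + 1) *
        f (Matrix.vecCons (y j) (i.removeNth x)) (Matrix.vecCons (x i) (j.removeNth y))) := by
    intro x y
    simp only [lower_apply, raise_apply, Fin.sum_univ_succ (n := b + 1), mul_add,
      Finset.sum_add_distrib, Finset.mul_sum]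
    congr 1
    · have h3 : ∀ i : Fin (a + 1), (-1) ^ (i : ℕ) *
          f (Matrix.vecCons (x i) (i.removeNth x)) y = f x y := fun i =>
        neg_one_pow_mul_removeNth (f.flip y) x i
      simp [h3]
    · simp [removeNth_succ_vecCons]
  ext x y
  simp only [AlternatingMap.add_apply, AlternatingMap.smul_apply, smul_eq_mul, h1, h2]
  rw [Finset.sum_comm]
  have h4 : ∀ (i : Fin (a + 1)) (j : Fin (b + 1)) (t : K),
      (-1) ^ (j : ℕ) * ((-1) ^ ((i : ℕ) + 1) * t) = (-1) ^ (i : ℕ) * ((-1) ^ ((j : ℕ) + 1) * t) :=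
    fun i j t => by ring
  simp only [h4]
  ring

theorem raise_lower_zero {a : ℕ} (f : BiForm K V (a + 1) 0) :
    raise a 0 (lower a 0 f) = ((a + 1 : ℕ) : K) • f := by
  ext x y
  have h3 : ∀ i : Fin (a + 1), (-1) ^ (i : ℕ) *
      f (Matrix.vecCons (x i) (i.removeNth x)) y = f x y := fun i =>
    neg_one_pow_mul_removeNth (f.flip y) x i
  have h4 : ∀ (i : Fin (a + 1)), Fin.removeNth (α := fun _ => V) 0 (Matrix.vecCons (x i) y) = y :=
    fun i => rfl
  simp [raise_apply, lower_apply, h4, h3]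

/-- In characteristic zero `D E` has no eigenvalue `-c ≤ 0` on forms of positive weight. -/
theorem eq_zero_of_raise_lower [CharZero K] (b : ℕ) : ∀ (a c : ℕ), b ≤ a →
    ∀ f : BiForm K V (a + 1) b, raise a b (lower a b f) + (c : K) • f = 0 → f = 0 := by
  induction b with
  | zero =>
    intro a c _ f hf
    rw [raise_lower_zero, ← add_smul] at hf
    refine (smul_eq_zero.1 hf).resolve_left ?_
    exact_mod_cast (by omega : a + 1 + c ≠ 0)
  | succ b ih =>
    intro a c hab f hf
    obtain ⟨e, rfl⟩ := Nat.exists_eq_add_of_le hab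
    -- The commutator rule raises the constant by the weight `e + 1`. Applying `raise` then puts
    -- `raise f` under the induction hypothesis, which leaves a positive multiple of `f` equal to
    -- zero.
    have h1 : lower (b + 1 + e + 1) b (raise (b + 1 + e + 1) b f) +
        ((c + e + 1 : ℕ) : K) • f = 0 := by
      have h : _ + (c : K) • f = _ + (c : K) • f := congrArg (· + (c : K) • f) (lower_raise f)
      rw [add_right_comm (raise _ _ _), hf, zero_add] at h
      refine BiForm.add_right_cancel (h := ((b + 1 : ℕ) : K) • f)
        (Eq.trans ?_ (h.trans (zero_add _).symm))
      rw [add_assoc (lower _ b _), add_assoc (lower _ b _), ← add_smul, ← add_smul]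
      congr 2
      push_cast
      ring
    have h2 : raise (b + 1 + e + 1) b f = 0 := by
      refine ih (b + 1 + e + 1) (c + e + 1) (by omega) _ ?_
      rw [← map_smul, ← map_add, h1, map_zero]
    rw [h2, map_zero, zero_add] at h1
    refine (smul_eq_zero.1 h1).resolve_left ?_
    exact_mod_cast Nat.succ_ne_zero (c + e)

theorem eq_zero_of_lower_eq_zero [CharZero K] {a b : ℕ} (hab : b ≤ a) {f : BiForm K V (a + 1) b}
    (hf : lower a b f = 0) : f = 0 :=
  eq_zero_of_raise_lower b a 0 hab f (by simp [hf])

/-- The forms of weight one which satisfy the identity that the generalized Jacobi identity imposes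
on `[[x₀, …, x_p], y₁, …, y_p]`. -/
def jacobiForms (K V : Type*) [Field K] [AddCommGroup V] [Module K V] (p : ℕ) :
    Submodule K (BiForm K V (p + 1) p) :=
  LinearMap.eqLocus (flipₗ p (p + 1) ∘ₗ lower p p) LinearMap.id

theorem mem_jacobiForms {p : ℕ} {f : BiForm K V (p + 1) p} :
    f ∈ jacobiForms K V p ↔ (lower p p f).flip = f := Iff.rfl

theorem mem_jacobiForms_iff_apply {p : ℕ} {f : BiForm K V (p + 1) p} :
    f ∈ jacobiForms K V p ↔ ∀ x y, f x y = ∑ i : Fin (p + 1),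
      (-1) ^ (i : ℕ) * f (Matrix.vecCons (x i) y) (i.removeNth x) := by
  rw [mem_jacobiForms]
  constructor
  · intro h x y
    conv_lhs => rw [← h]
    exact lower_apply f y x
  · intro h
    ext x y
    rw [h x y]
    exact lower_apply f y x

end BiForm

end biforms

/-! ### Dimension of the space of Jacobi forms in characteristic zero -/

section jacobiDimension

variable {K : Type*} [Field K] {V : Type*} [AddCommGroup V] [Module K V]

/-- The injective endomorphism `f ∘ g` of a finite-dimensional space is onto, hence so is `f`; then
rank-nullity applies. -/
theorem finrank_ker_add_of_injective_comp {M N : Type*} [AddCommMonoid M] [Module K M]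
    [AddCommMonoid N] [Module K N] [Module.Finite K M] [Module.Finite K N] (f : M →ₗ[K] N)
    (g : N →ₗ[K] M) (h : ∀ x, f (g x) = 0 → x = 0) :
    Module.finrank K (LinearMap.ker f) + Module.finrank K N = Module.finrank K M := by
  let _ := Module.addCommMonoidToAddCommGroup K (M := M)
  let _ := Module.addCommMonoidToAddCommGroup K (M := N)
  have hinj : Function.Injective (f ∘ₗ g) := (injective_iff_map_eq_zero _).2 h
  have hsurj : Function.Surjective (f ∘ₗ g) := LinearMap.injective_iff_surjective.1 hinj
  have hf : LinearMap.range f = ⊤ := LinearMap.range_eq_top.2 (Function.Surjective.of_comp hsurj)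
  rw [← f.finrank_range_add_finrank_ker, hf, finrank_top, add_comm]

theorem finite_of_injective {M N : Type*} [AddCommMonoid M] [Module K M]
    [AddCommMonoid N] [Module K N] [Module.Finite K N] (f : M →ₗ[K] N)
    (h : Function.Injective f) : Module.Finite K M := by
  let _ := Module.addCommMonoidToAddCommGroup K (M := N)
  exact Module.Finite.of_injective f h

theorem AlternatingMap.map_vecCons_swap {N : Type*} [AddCommGroup N] [Module K N] {a : ℕ}
    (f : V [⋀^Fin (a + 2)]→ₗ[K] N) (u v : V) (x : Fin a → V) :
    f (Matrix.vecCons u (Matrix.vecCons v x)) = -f (Matrix.vecCons v (Matrix.vecCons u x)) := by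
  rw [f.map_eq_removeNth (Matrix.vecCons u (Matrix.vecCons v x)) (Fin.succ 0),
    removeNth_succ_vecCons, removeNth_zero_vecCons]
  simp

theorem AlternatingMap.map_vecCons_self {N : Type*} [AddCommGroup N] [Module K N] {a : ℕ}
    (f : V [⋀^Fin (a + 2)]→ₗ[K] N) (u : V) (x : Fin a → V) :
    f (Matrix.vecCons u (Matrix.vecCons u x)) = 0 :=
  f.map_eq_zero_of_eq (i := 0) (j := 1) _ rfl (by simp)

namespace BiForm

/-- Substitution of the same vector for the first variable of each group. -/
def subst {a b : ℕ} (c : V) (f : BiForm K V (a + 1) (b + 1)) : BiForm K V a b :=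
  flip (AlternatingMap.curryLeft (flip (a := a) (b := b + 1) (f.curryLeft c)) c)

theorem subst_apply {a b : ℕ} (c : V) (f : BiForm K V (a + 1) (b + 1)) (x : Fin a → V)
    (y : Fin b → V) : f.subst c x y = f (Matrix.vecCons c x) (Matrix.vecCons c y) := rfl

/-- Moving `c` itself repeats it in the second group and gives zero. In the other terms the swap of
`xᵢ` with `c` cancels the sign of the index shift. -/
theorem raise_subst {a b : ℕ} (c : V) (f : BiForm K V (a + 1) (b + 2)) (x : Fin (a + 1) → V)
    (y : Fin b → V) :
    raise a b (f.subst c) x y =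
      raise (a + 1) (b + 1) f (Matrix.vecCons c x) (Matrix.vecCons c y) := by
  rw [raise_apply, raise_apply, Fin.sum_univ_succ (n := a + 1)]
  simp only [removeNth_succ_vecCons, removeNth_zero_vecCons, Matrix.cons_val_zero,
    Matrix.cons_val_succ, AlternatingMap.map_vecCons_self, subst_apply]
  rw [mul_zero, zero_add]
  refine Finset.sum_congr rfl fun i _ => ?_
  rw [AlternatingMap.map_vecCons_swap _ c, Fin.val_succ, pow_succ]
  ring

theorem lower_subst {a b : ℕ} (c : V) (f : BiForm K V (a + 2) (b + 1)) (x : Fin a → V)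
    (y : Fin (b + 1) → V) :
    lower a b (f.subst c) x y =
      lower (a + 1) (b + 1) f (Matrix.vecCons c x) (Matrix.vecCons c y) :=
  raise_subst c f.flip y x

/-- A form that vanishes whenever the first variables of the two groups coincide vanishes if it is
killed by `raise`. -/
theorem eq_zero_of_subst_eq_zero [CharZero K] {a b : ℕ} {f : BiForm K V (a + 1) (b + 1)}
    (hr : raise (a + 1) b f = 0) (hf : ∀ c, f.subst c = 0) : f = 0 := by
  have hdiag : ∀ (c : V) (x : Fin a → V) (y : Fin b → V),
      f (Matrix.vecCons c x) (Matrix.vecCons c y) = 0 := fun c x y => by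
    rw [← subst_apply, hf]
    rfl
  -- Polarization of `hdiag`.
  have hanti : ∀ (u v : V) (x : Fin a → V) (y : Fin b → V),
      f (Matrix.vecCons u x) (Matrix.vecCons v y) =
        -f (Matrix.vecCons v x) (Matrix.vecCons u y) := by
    intro u v x y
    have h := hdiag (u + v) x y
    rw [AlternatingMap.map_vecCons_add f, AlternatingMap.add_apply, AlternatingMap.map_vecCons_add,
      AlternatingMap.map_vecCons_add, hdiag, hdiag, zero_add, add_zero] at h
    exact eq_neg_of_add_eq_zero_left h
  have hzero : ∀ (v : V) (x : Fin (a + 1) → V) (y : Fin b → V), f x (Matrix.vecCons v y) = 0 := by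
    intro v x y
    have h : raise (a + 1) b f (Matrix.vecCons v x) y = 0 := by
      rw [hr]
      rfl
    rw [raise_apply, Fin.sum_univ_succ] at h
    -- By `hanti` all `a + 2` terms of `raise f (v,x; y)` equal `f (x; v,y)`.
    have h1 : ∀ i : Fin (a + 1), (-1) ^ (i.succ : ℕ) *
        f (i.succ.removeNth (Matrix.vecCons v x))
          (Matrix.vecCons (Matrix.vecCons v x i.succ) y) = f x (Matrix.vecCons v y) := by
      intro i
      have h2 : (-1) ^ (i : ℕ) * f (Matrix.vecCons (x i) (i.removeNth x)) (Matrix.vecCons v y) =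
          f x (Matrix.vecCons v y) :=
        neg_one_pow_mul_removeNth (f.flip (Matrix.vecCons v y)) x i
      rw [removeNth_succ_vecCons, Matrix.cons_val_succ, hanti, Fin.val_succ, pow_succ, ← h2]
      ring
    simp only [h1] at h
    rw [Finset.sum_const, Finset.card_univ, Fintype.card_fin, removeNth_zero_vecCons] at h
    simp only [Fin.val_zero, pow_zero, one_mul, Matrix.cons_val_zero, nsmul_eq_mul] at h
    have h3 : ((a + 2 : ℕ) : K) * f x (Matrix.vecCons v y) = 0 := by
      rw [← h]
      push_cast
      ring
    refine (mul_eq_zero.1 h3).resolve_left ?_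
    exact_mod_cast Nat.succ_ne_zero (a + 1)
  ext x y
  rw [← Matrix.cons_head_tail y]
  exact hzero _ _ _

/-- The operator `f ↦ (E f)ᵗ` has no eigenvalue `-1` on the kernel of `raise`. -/
theorem eq_zero_of_flip_lower_add_self [CharZero K] (p : ℕ) : ∀ f : BiForm K V (p + 2) (p + 1),
    raise (p + 2) p f = 0 → (lower (p + 1) (p + 1) f).flip + f = 0 → f = 0 := by
  -- Substitution commutes with both antisymmetrizations, so both hypotheses pass to forms with one
  -- variable fewer in each group.
  have hsub : ∀ (p : ℕ) (f : BiForm K V (p + 2) (p + 1)),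
      (lower (p + 1) (p + 1) f).flip + f = 0 →
        ∀ c, (lower p p (f.subst c)).flip + f.subst c = 0 := by
    intro p f hf c
    ext x y
    rw [AlternatingMap.add_apply, AlternatingMap.add_apply, flip_apply, lower_subst, subst_apply]
    exact DFunLike.congr_fun (DFunLike.congr_fun hf (Matrix.vecCons c x)) (Matrix.vecCons c y)
  induction p with
  | zero =>
    intro f hr hf
    refine eq_zero_of_subst_eq_zero hr fun c => ?_
    have h := hsub 0 f hf c
    ext x y
    have h1 := DFunLike.congr_fun (DFunLike.congr_fun h x) y
    rw [AlternatingMap.add_apply, AlternatingMap.add_apply, flip_apply, lower_apply,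
      Fin.sum_univ_one] at h1
    -- On forms in one variable the operator is the identity, so the equation reads `2 f = 0`.
    have h2 : Matrix.vecCons (x 0) y = x := by
      ext i
      rw [Subsingleton.elim i 0]
      rfl
    rw [h2, Subsingleton.elim (Fin.removeNth 0 x) y] at h1
    simpa using h1
  | succ p ih =>
    intro f hr hf
    refine eq_zero_of_subst_eq_zero hr fun c => ih _ ?_ (hsub _ f hf c)
    ext x y
    rw [raise_subst, hr]
    rfl

theorem raise_lower_of_mem_jacobiForms {p : ℕ} {f : BiForm K V (p + 1) p}
    (hf : f ∈ jacobiForms K V p) : raise p p (lower p p f) = f := by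
  rw [mem_jacobiForms] at hf
  change (lower p p (lower p p f).flip).flip = f
  rw [hf, hf]

/-- Let `T f = (lower f)ᵗ`, so `T² f = raise (lower f)`. On weight one the commutator rule says
`lower (raise f) + f = T² f`. If `T f = f`, then `lower (raise f) = 0`, and `lower` is injective
there. If `raise f = 0`, then `T² f = f`, so `T f - f` satisfies `T g = -g`; it is also killed by
`raise`, hence vanishes by `eq_zero_of_flip_lower_add_self`. -/
theorem jacobiForms_eq_ker_raise [CharZero K] (q : ℕ) :
    jacobiForms K V (q + 1) = LinearMap.ker (raise (K := K) (V := V) (q + 2) q) := by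
  have hcast : ((q + 1 + 1 : ℕ) : K) = ((q + 1 : ℕ) : K) + 1 := by push_cast; ring
  ext f
  rw [LinearMap.mem_ker]
  constructor
  · intro hf
    have h := lower_raise f
    rw [raise_lower_of_mem_jacobiForms hf, hcast, add_smul, one_smul,
      add_comm f] at h
    exact eq_zero_of_lower_eq_zero (by omega) (BiForm.add_right_cancel (h.trans (zero_add _).symm))
  · intro hf
    have h := lower_raise f
    rw [hf, map_zero, zero_add, hcast, add_smul, one_smul, add_comm _ f] at h
    have hrl : raise (q + 1) (q + 1) (lower (q + 1) (q + 1) f) = f :=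
      (BiForm.add_right_cancel h).symm
    -- The commutator rule at `lower f` gives `raise (lower (lower f)) = 0`; injectivity, after
    -- `flip`, gives `lower (lower f) = 0`, which is `raise (T f) = 0` up to `flip`.
    have h' := lower_raise (lower (q + 1) (q + 1) f)
    rw [hrl] at h'
    have hrll : raise q (q + 2) (lower q (q + 2) (lower (q + 1) (q + 1) f)) = 0 := by
      refine (BiForm.add_right_cancel (h := ((q + 1 + 1 : ℕ) : K) • lower (q + 1) (q + 1) f)
        (Eq.trans ?_ h')).symm
      rw [zero_add, hcast, add_smul, one_smul, add_comm (((q + 1 : ℕ) : K) • _)]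
    have hll : lower q (q + 2) (lower (q + 1) (q + 1) f) = 0 := by
      have h1 : lower (q + 2) q (lower q (q + 2) (lower (q + 1) (q + 1) f)).flip = 0 := by
        rw [← flip_raise, hrll]
        rfl
      have h2 := eq_zero_of_lower_eq_zero (by omega) h1
      rw [← flip_flip (lower q (q + 2) (lower (q + 1) (q + 1) f)), h2]
      rfl
    have h0 : (lower (q + 1) (q + 1) f).flip + (-1 : K) • f = 0 := by
      refine eq_zero_of_flip_lower_add_self q _ ?_ ?_
      · rw [map_add, map_smul, hf, ← flip_lower, hll]
        ext x y
        simp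
      · have h1 : (lower (q + 1) (q + 1) (lower (q + 1) (q + 1) f).flip).flip = f := hrl
        rw [map_add, map_smul]
        ext x y
        have h2 := DFunLike.congr_fun (DFunLike.congr_fun h1 x) y
        rw [flip_apply] at h2
        simp [h2]
    rw [mem_jacobiForms]
    ext x y
    have h1 := DFunLike.congr_fun (DFunLike.congr_fun h0 x) y
    simpa [add_neg_eq_zero] using h1

theorem finite_and_finrank [Module.Finite K V] (a b : ℕ) : Module.Finite K (BiForm K V a b) ∧
    Module.finrank K (BiForm K V a b) =
      (Module.finrank K V).choose a * (Module.finrank K V).choose b := by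
  have e1 : (V [⋀^Fin b]→ₗ[K] K) ≃ₗ[K] (⋀[K]^b V →ₗ[K] K) := exteriorPower.alternatingMapLinearEquiv
  have e2 : BiForm K V a b ≃ₗ[K] (⋀[K]^a V →ₗ[K] V [⋀^Fin b]→ₗ[K] K) :=
    exteriorPower.alternatingMapLinearEquiv
  have hf : Module.Finite K (V [⋀^Fin b]→ₗ[K] K) := Module.Finite.equiv e1.symm
  refine ⟨Module.Finite.equiv e2.symm, ?_⟩
  rw [e2.finrank_eq, Module.finrank_linearMap, e1.finrank_eq, Module.finrank_linearMap,
    exteriorPower.finrank_eq, exteriorPower.finrank_eq, Module.finrank_self, mul_one]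

/-- `raise` is onto because `raise ∘ lower` is injective on its target, a space of weight `3`. -/
theorem finrank_jacobiForms [CharZero K] [Module.Finite K V] (q : ℕ) :
    Module.finrank K (jacobiForms K V (q + 1)) +
      (Module.finrank K V).choose (q + 3) * (Module.finrank K V).choose q =
      (Module.finrank K V).choose (q + 2) * (Module.finrank K V).choose (q + 1) := by
  have hfin : ∀ a b, Module.Finite K (BiForm K V a b) := fun a b => (finite_and_finrank a b).1
  rw [jacobiForms_eq_ker_raise, ← (finite_and_finrank (K := K) (V := V) (q + 3) q).2,
    ← (finite_and_finrank (K := K) (V := V) (q + 2) (q + 1)).2]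
  refine finrank_ker_add_of_injective_comp _ (lower (q + 2) q) fun f hf => ?_
  refine eq_zero_of_raise_lower q (q + 2) 0 (by omega) f ?_
  rw [hf, Nat.cast_zero, zero_smul, add_zero]

end BiForm

end jacobiDimension

/-! ### A class-three algebra realizing a given Jacobi form -/

section jacobiExtension

variable {K : Type*} [Field K] {V : Type*} [AddCommGroup V] [Module K V] {p : ℕ}

namespace BiForm

/-- `V ⊕ Λ^{p+1} V ⊕ K`, the space of a nilpotent `(p+1)`-Lie algebra of class three. -/
abbrev ExtSpace (K V : Type*) [Field K] [AddCommGroup V] [Module K V] (p : ℕ) : Type _ :=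
  V × (⋀[K]^(p + 1) V) × K

/-- The bracket `[u₀, …, u_p] = (0, v₀ ∧ … ∧ v_p, ∑ᵢ ± β(wᵢ; v̂ᵢ))` of the vectors
`uᵢ = (vᵢ, wᵢ, cᵢ)`. -/
noncomputable def extBracket (β : BiForm K V (p + 1) p) :
    ExtSpace K V p [⋀^Fin (p + 1)]→ₗ[K] ExtSpace K V p :=
  AlternatingMap.prod 0 (AlternatingMap.prod
    ((exteriorPower.ιMulti K (p + 1)).compLinearMap (LinearMap.fst K V _))
    (AlternatingMap.alternatizeUncurryFin
      { toFun := fun u => (exteriorPower.alternatingMapLinearEquiv β u.2.1).compLinearMap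
          (LinearMap.fst K V _)
        map_add' := fun u v => by ext; simp
        map_smul' := fun c u => by ext; simp }))

theorem extBracket_apply (β : BiForm K V (p + 1) p) (u : Fin (p + 1) → ExtSpace K V p) :
    extBracket β u = (0, exteriorPower.ιMulti K (p + 1) (fun i => (u i).1),
      ∑ i : Fin (p + 1), (-1) ^ (i : ℕ) *
        exteriorPower.alternatingMapLinearEquiv β (u i).2.1 (i.removeNth fun k => (u k).1)) := by
  refine Prod.ext rfl (Prod.ext rfl ?_)
  refine (AlternatingMap.alternatizeUncurryFin_apply _ _).trans ?_
  refine Finset.sum_congr rfl fun i _ => ?_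
  rw [zsmul_eq_mul]
  push_cast
  rfl

/-- A zero `V`-component kills the wedge and every summand in which it is an argument of `β`; only
the summand fed with the exterior component of `c` survives. -/
theorem extBracket_vecCons (β : BiForm K V (p + 1) p) {c : ExtSpace K V p} (hc : c.1 = 0)
    (u : Fin p → ExtSpace K V p) :
    extBracket β (Matrix.vecCons c u) =
      (0, 0, exteriorPower.alternatingMapLinearEquiv β c.2.1 fun k => (u k).1) := by
  have hfst : (fun i => (Matrix.vecCons c u i).1) = Matrix.vecCons 0 fun k => (u k).1 := by
    funext i
    refine Fin.cases ?_ (fun k => ?_) i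
    · exact hc
    · rfl
  rw [extBracket_apply, hfst]
  refine Prod.ext rfl (Prod.ext ?_ ?_)
  · exact AlternatingMap.map_coord_zero _ 0 rfl
  · change ∑ i : Fin (p + 1), _ = _
    rw [Fin.sum_univ_succ, Finset.sum_eq_zero, add_zero]
    · simp
    · intro i _
      cases p with
      | zero => exact i.elim0
      | succ q =>
        rw [removeNth_succ_vecCons, AlternatingMap.map_coord_zero _ 0 rfl, mul_zero]

/-- A form satisfying the Jacobi condition defines an `n`-Lie algebra. -/
@[reducible] noncomputable def extAlgebra (β : BiForm K V (p + 1) p)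
    (hβ : β ∈ jacobiForms K V p) : NLieAlgebra K (p + 1) (ExtSpace K V p) where
  bracket := extBracket β
  jacobi j x y := by
    have hfst : ∀ u, (extBracket β u).1 = 0 := fun u => rfl
    have hcons : ∀ i, (fun k => (Matrix.vecCons (x i) (j.removeNth y) k).1) =
        Matrix.vecCons (x i).1 fun k => (j.removeNth y k).1 := fun i => by
      funext k
      refine Fin.cases ?_ (fun k => ?_) k <;> rfl
    rw [AlternatingMap.map_update_eq_removeNth, extBracket_vecCons β (hfst x)]
    -- Inner brackets have no `V`-component, so both sides of the Jacobi identity reduce to values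
    -- of `β` in the last coordinate, with common sign `(-1) ^ j`.
    have hterm : ∀ i : Fin (p + 1),
        extBracket β (Function.update x i (extBracket β (Function.update y j (x i)))) =
        (-1 : ℤ) ^ (j : ℕ) • (0, 0, (-1) ^ (i : ℕ) *
          β (Matrix.vecCons (x i).1 fun k => (j.removeNth y k).1)
            (i.removeNth fun k => (x k).1)) := by
      intro i
      rw [AlternatingMap.map_update_eq_removeNth, extBracket_vecCons β (hfst _),
        AlternatingMap.map_update_eq_removeNth (extBracket β) y j, extBracket_apply, hcons]
      refine Prod.ext (by simp) (Prod.ext (by simp) ?_)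
      simp only [Prod.smul_mk, map_zsmul, exteriorPower.alternatingMapLinearEquiv_apply_ιMulti]
      simp [mul_left_comm]
      rfl
    simp only [hterm]
    rw [← Finset.smul_sum]
    congr 1
    refine Prod.ext (by simp [Prod.fst_sum]) (Prod.ext (by simp [Prod.fst_sum, Prod.snd_sum]) ?_)
    rw [Prod.snd_sum, Prod.snd_sum]
    rw [extBracket_apply]
    simp only [exteriorPower.alternatingMapLinearEquiv_apply_ιMulti]
    exact mem_jacobiForms_iff_apply.1 hβ _ _

end BiForm

end jacobiExtension

/-! ### The dual of `F³/F⁴` -/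

section freeQuotient

variable {K : Type*} [Field K] {d p : ℕ}

namespace FreeNLie

/-- The span of the free generators as the image of the coordinate space. -/
noncomputable def linearPart (K : Type*) [Field K] (n d : ℕ) :
    (Fin d → K) →ₗ[K] FreeNLie K n (Fin d) :=
  Fintype.linearCombination K FreeNLie.of

theorem exists_sub_linearPart_mem {n : ℕ} [NeZero n] (a : FreeNLie K n (Fin d)) :
    ∃ v, a - linearPart K n d v ∈ (lowerCentral K n (FreeNLie K n (Fin d)) 2).toSubmodule := by
  obtain ⟨s, hs, f, hf, rfl⟩ := Submodule.mem_sup.1 (FreeNLie.mem_span_of_sup_bracketIdeal a)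
  obtain ⟨c, rfl⟩ := (Submodule.mem_span_range_iff_exists_fun K).1 hs
  refine ⟨c, ?_⟩
  rw [linearPart, Fintype.linearCombination_apply, add_sub_cancel_left]
  exact hf

/-- The coefficients of a functional on the double brackets `[[x₀, …, x_p], y₁, …, y_p]` of linear
combinations of generators. -/
noncomputable def bracketForm (p d : ℕ) :
    (FreeNLie K (p + 1) (Fin d) →ₗ[K] K) →ₗ[K] BiForm K (Fin d → K) (p + 1) p where
  toFun μ := LinearMap.compAlternatingMap
    { toFun := fun u => μ.compAlternatingMap
        (((nbr K (p + 1)).curryLeft u).compLinearMap (linearPart K (p + 1) d))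
      map_add' := fun u v => by ext; simp
      map_smul' := fun c u => by ext; simp }
    ((nbr K (p + 1)).compLinearMap (linearPart K (p + 1) d))
  map_add' μ ν := by ext; rfl
  map_smul' c μ := by ext; rfl

theorem bracketForm_apply (μ : FreeNLie K (p + 1) (Fin d) →ₗ[K] K) (x : Fin (p + 1) → Fin d → K)
    (y : Fin p → Fin d → K) :
    bracketForm p d μ x y = μ (nbr K (p + 1) (Matrix.vecCons
      (nbr K (p + 1) fun i => linearPart K (p + 1) d (x i))
      fun i => linearPart K (p + 1) d (y i))) := rfl

theorem bracketForm_mem_jacobiForms (μ : FreeNLie K (p + 1) (Fin d) →ₗ[K] K) :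
    bracketForm p d μ ∈ BiForm.jacobiForms K (Fin d → K) p := by
  refine BiForm.mem_jacobiForms_iff_apply.2 fun x y => ?_
  rw [bracketForm_apply, nbr_vecCons_nbr, map_sum]
  refine Finset.sum_congr rfl fun i _ => ?_
  rw [map_zsmul, zsmul_eq_mul, bracketForm_apply]
  have h : (fun k => linearPart K (p + 1) d (Matrix.vecCons (x i) y k)) =
      Matrix.vecCons (linearPart K (p + 1) d (x i)) fun k => linearPart K (p + 1) d (y k) := by
    funext k
    refine Fin.cases ?_ (fun k => ?_) k <;> rfl
  rw [h]
  push_cast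
  rfl

/-- A functional which kills `F⁴` and the double brackets of linear combinations of generators
kills `F³`. -/
theorem lowerCentral_three_le_ker_of_bracketForm {μ : FreeNLie K (p + 1) (Fin d) →ₗ[K] K}
    (h4 : (lowerCentral K (p + 1) (FreeNLie K (p + 1) (Fin d)) 4).toSubmodule ≤ LinearMap.ker μ)
    (h : bracketForm p d μ = 0) :
    (lowerCentral K (p + 1) (FreeNLie K (p + 1) (Fin d)) 3).toSubmodule ≤ LinearMap.ker μ := by
  refine bracketIdeal_le_of_vecCons fun u hu y => ?_
  have key : (lowerCentral K (p + 1) (FreeNLie K (p + 1) (Fin d)) 2).toSubmodule ≤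
      LinearMap.ker (μ ∘ₗ
        (nbr K (p + 1)).toMultilinearMap.toLinearMap (Matrix.vecCons 0 y) 0) := by
    refine bracketIdeal_le fun x _ _ => ?_
    change μ (nbr K (p + 1) (Function.update (Matrix.vecCons 0 y) 0 (nbr K (p + 1) x))) = 0
    rw [update_vecCons_zero]
    choose v hv using fun i => exists_sub_linearPart_mem (x i)
    choose w hw using fun i => exists_sub_linearPart_mem (y i)
    have hx := nbr_sub_mem_bracketIdeal (lowerCentral K (p + 1) (FreeNLie K (p + 1) (Fin d)) 2) hv
    -- Replacing all entries by their linear parts changes them by `F²`, and so the double bracket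
    -- by `γ₃(F²,F,…,F) = F⁴`.
    have hmem := nbr_sub_mem_gammaSucc_two
      (lowerCentral K (p + 1) (FreeNLie K (p + 1) (Fin d)) 2)
      (x := Matrix.vecCons (nbr K (p + 1) x) y)
      (y := Matrix.vecCons (nbr K (p + 1) fun i => linearPart K (p + 1) d (v i))
        fun i => linearPart K (p + 1) d (w i)) 0 (mem_lowerCentral_two _) (mem_lowerCentral_two _)
      hx (fun k => by
        refine Fin.cases ?_ (fun k => ?_) k
        · exact bracketIdeal_le_self _ hx
        · exact hw k)
    have h0 := LinearMap.mem_ker.1 (h4 hmem)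
    rw [map_sub, sub_eq_zero] at h0
    rw [h0, ← bracketForm_apply, h]
    rfl
  have hmem := LinearMap.mem_ker.1 (key hu)
  change μ (nbr K (p + 1) (Function.update (Matrix.vecCons 0 y) 0 u)) = 0 at hmem
  rwa [update_vecCons_zero] at hmem

/-- Every form satisfying the Jacobi condition comes from a functional which kills `F⁴`. -/
theorem exists_bracketForm_eq {β : BiForm K (Fin d → K) (p + 1) p}
    (hβ : β ∈ BiForm.jacobiForms K (Fin d → K) p) :
    ∃ μ : FreeNLie K (p + 1) (Fin d) →ₗ[K] K,
      (lowerCentral K (p + 1) (FreeNLie K (p + 1) (Fin d)) 4).toSubmodule ≤ LinearMap.ker μ ∧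
        bracketForm p d μ = β := by
  let _ := BiForm.extAlgebra β hβ
  let Λ : NLieHom K (p + 1) (FreeNLie K (p + 1) (Fin d)) (BiForm.ExtSpace K (Fin d → K) p) :=
    lift fun i => (Pi.single i 1, 0, 0)
  have hbr : ∀ u : Fin (p + 1) → BiForm.ExtSpace K (Fin d → K) p,
      nbr K (p + 1) u = BiForm.extBracket β u := fun _ => rfl
  have hΛ : ∀ v, Λ.toLinearMap (linearPart K (p + 1) d v) = (v, 0, 0) := by
    intro v
    rw [linearPart, Fintype.linearCombination_apply, map_sum]
    have h : ∀ i, Λ.toLinearMap (v i • of i) =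
        LinearMap.inl K (Fin d → K) ((⋀[K]^(p + 1) (Fin d → K)) × K) (v i • Pi.single i 1) := by
      intro i
      rw [map_smul, map_smul]
      rfl
    simp only [h]
    rw [← map_sum]
    exact congrArg (LinearMap.inl K (Fin d → K) ((⋀[K]^(p + 1) (Fin d → K)) × K))
      (pi_eq_sum_univ' v).symm
  refine ⟨LinearMap.snd K _ K ∘ₗ LinearMap.snd K _ _ ∘ₗ Λ.toLinearMap, ?_, ?_⟩
  -- `P = Λ^{p+1}V ⊕ K` contains the second term of the lower central series and `Q = K` the third,
  -- so the fourth is zero.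
  · let P : Submodule K (BiForm.ExtSpace K (Fin d → K) p) := LinearMap.ker (LinearMap.fst K _ _)
    let Q : Submodule K (BiForm.ExtSpace K (Fin d → K) p) :=
      P ⊓ LinearMap.ker (LinearMap.fst K _ K ∘ₗ LinearMap.snd K _ _)
    have h2 : (lowerCentral K (p + 1) (BiForm.ExtSpace K (Fin d → K) p) 2).toSubmodule ≤ P :=
      bracketIdeal_le fun _ _ _ => rfl
    have h3 : (lowerCentral K (p + 1) (BiForm.ExtSpace K (Fin d → K) p) 3).toSubmodule ≤ Q := by
      refine bracketIdeal_le_of_vecCons fun u hu y => ?_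
      rw [hbr, BiForm.extBracket_vecCons β (h2 hu)]
      exact ⟨rfl, rfl⟩
    have h4 : (lowerCentral K (p + 1) (BiForm.ExtSpace K (Fin d → K) p) 4).toSubmodule ≤ ⊥ := by
      refine bracketIdeal_le_of_vecCons fun u hu y => ?_
      have hu1 : u.1 = 0 := (h3 hu).1
      have hu2 : u.2.1 = 0 := (h3 hu).2
      rw [hbr, BiForm.extBracket_vecCons β hu1, hu2, map_zero]
      rfl
    intro a ha
    have h := (Submodule.mem_bot K).1 (h4 (Λ.map_lowerCentral 4 a ha))
    rw [LinearMap.mem_ker, LinearMap.comp_apply, LinearMap.comp_apply, h]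
    rfl
  · ext x y
    rw [bracketForm_apply, LinearMap.comp_apply, LinearMap.comp_apply, Λ.map_bracket]
    have h1 : (fun i => Λ.toLinearMap (Matrix.vecCons
        (nbr K (p + 1) fun i => linearPart K (p + 1) d (x i))
        (fun i => linearPart K (p + 1) d (y i)) i)) =
        Matrix.vecCons (nbr K (p + 1) fun i => (x i, 0, 0)) fun i => (y i, 0, 0) := by
      funext i
      refine Fin.cases ?_ (fun i => ?_) i
      · change Λ.toLinearMap (nbr K (p + 1) fun i => linearPart K (p + 1) d (x i)) = _
        rw [Λ.map_bracket]
        simp only [hΛ]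
        rfl
      · exact hΛ (y i)
    rw [h1, hbr, hbr, BiForm.extBracket_vecCons β rfl, BiForm.extBracket_apply]
    exact congrArg (fun f => f y) (exteriorPower.alternatingMapLinearEquiv_apply_ιMulti β x)

/-- The dual of `F³/F⁴` is the space of forms satisfying the Jacobi condition. -/
theorem exists_dual_lowerCentralQuot_equiv (p d : ℕ) :
    Nonempty (Module.Dual K (lowerCentralQuot K (p + 1) d 3) ≃ₗ[K]
      BiForm.jacobiForms K (Fin d → K) p) := by
  let F := FreeNLie K (p + 1) (Fin d)
  let F3 := (lowerCentral K (p + 1) F 3).toSubmodule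
  let F4 := (lowerCentral K (p + 1) F 4).toSubmodule
  have hF : F4 ≤ F3 := bracketIdeal_le_self _
  -- A linear retraction onto `F³` extends functionals to `F`; the form sees only their values on
  -- `F³`, so the choice is harmless.
  obtain ⟨r, hr⟩ := F3.subtype.exists_leftInverse_of_injective F3.ker_subtype
  have hr' : ∀ a (ha : a ∈ F3), r a = ⟨a, ha⟩ := fun a ha => LinearMap.congr_fun hr ⟨a, ha⟩
  let ext : Module.Dual K (F3 ⧸ F4.submoduleOf F3) →ₗ[K] Module.Dual K F :=
    ((F4.submoduleOf F3).mkQ ∘ₗ r).dualMap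
  have hext : ∀ ℓ a (ha : a ∈ F3), ext ℓ a = ℓ (Submodule.Quotient.mk ⟨a, ha⟩) := fun ℓ a ha =>
    congrArg (fun b => ℓ (Submodule.Quotient.mk b)) (hr' a ha)
  let Θ : Module.Dual K (F3 ⧸ F4.submoduleOf F3) →ₗ[K] BiForm.jacobiForms K (Fin d → K) p :=
    (bracketForm p d ∘ₗ ext).codRestrict _ fun ℓ => bracketForm_mem_jacobiForms _
  refine ⟨LinearEquiv.ofBijective Θ ⟨?_, ?_⟩⟩
  · refine (injective_iff_map_eq_zero _).2 fun ℓ hℓ => ?_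
    have h4 : F4 ≤ LinearMap.ker (ext ℓ) := fun a ha => by
      rw [LinearMap.mem_ker, hext ℓ a (hF ha), (Submodule.Quotient.mk_eq_zero _).2, map_zero]
      exact ha
    have h3 := lowerCentral_three_le_ker_of_bracketForm h4 (congrArg Subtype.val hℓ)
    refine LinearMap.ext fun a => ?_
    obtain ⟨⟨a, ha⟩, rfl⟩ := Submodule.Quotient.mk_surjective _ a
    rw [← hext]
    exact h3 ha
  · rintro ⟨β, hβ⟩
    obtain ⟨μ, hμ4, hμ⟩ := exists_bracketForm_eq hβ
    refine ⟨(F4.submoduleOf F3).liftQ (μ ∘ₗ F3.subtype) fun a ha => hμ4 ha,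
      Subtype.ext (Eq.trans ?_ hμ)⟩
    change bracketForm p d (ext _) = _
    ext x y
    rw [bracketForm_apply, bracketForm_apply, hext _ _ ?_]
    · rfl
    · exact nbr_mem_bracketIdeal (lowerCentral K (p + 1) F 2) 0 (mem_lowerCentral_two _)

/-- The dual embeds in a finite-dimensional space of forms, in any characteristic. Without
finiteness the `finrank` in `basicNumber` would not determine the space. -/
theorem finite_lowerCentralQuot (p d : ℕ) :
    Module.Finite K (lowerCentralQuot K (p + 1) d 3) := by
  obtain ⟨e⟩ := exists_dual_lowerCentralQuot_equiv (K := K) p d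
  have := (BiForm.finite_and_finrank (K := K) (V := Fin d → K) (p + 1) p).1
  have : Module.Finite K (Module.Dual K (lowerCentralQuot K (p + 1) d 3)) :=
    finite_of_injective ((BiForm.jacobiForms K (Fin d → K) p).subtype ∘ₗ (e : _ →ₗ[K] _))
      (Subtype.val_injective.comp e.injective)
  exact (Module.finite_dual_iff K).1 this

theorem basicNumber_three [CharZero K] (q d : ℕ) :
    basicNumber K (q + 2) d 3 + d.choose (q + 3) * d.choose q =
      d.choose (q + 2) * d.choose (q + 1) := by
  obtain ⟨e⟩ := exists_dual_lowerCentralQuot_equiv (K := K) (q + 1) d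
  have h := BiForm.finrank_jacobiForms (K := K) (V := Fin d → K) q
  rw [← e.finrank_eq, Subspace.dual_finrank_eq, Module.finrank_fin_fun] at h
  exact h

end FreeNLie

end freeQuotient

/-! ### The theorem -/

theorem mainTheorem4 {K : Type*} [Field K] {n m : ℕ} [NeZero n] (hn : 2 ≤ n) (hm : 2 ≤ m)
    {L : Type*} [AddCommGroup L] [Module K L] [NLieAlgebra K n L]
    (hL : IsHeisenberg K n L) (hdim : Module.finrank K L = m * n + 1)
    {X : Type*} (π : NLieHom K n (FreeNLie K n X) L)
    (hπ : Function.Surjective π.toLinearMap) :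
    -- `M^(2)(L) ≅ A(l_{mn}^n(3))`
    Nonempty (NLieEquiv K n (nilMultiplier 2 π).toSubmodule
      (AbelianNLie K n (basicNumber K n (m * n) 3))) ∧
    -- in characteristic zero the number `l_{mn}^n(3)` is given by binomial coefficients
    (CharZero K → (basicNumber K n (m * n) 3 : ℤ) =
      (m * n).choose n * (m * n).choose (n - 1) -
        (m * n).choose (n + 1) * (m * n).choose (n - 2)) ∧
    -- `L/L^2` is abelian, and the natural map `M^(2)(L) → M^(2)(L/L^2)` is an isomorphism
    (∀ x : Fin n → L ⧸ (lowerCentral K n L 2).toSubmodule, nbr K n x = 0) ∧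
    ∃ e : NLieEquiv K n (nilMultiplier 2 π).toSubmodule
        (nilMultiplier 2 ((quotHom (lowerCentral K n L 2)).comp π)).toSubmodule,
      ∀ (f : FreeNLie K n X) (x : (nilMultiplier 2 π).toSubmodule),
        (x : FreeNLie K n X ⧸ (gammaSucc π.ker 2).toSubmodule) = Submodule.Quotient.mk f →
        (e.toLinearEquiv x : FreeNLie K n X ⧸
            (gammaSucc ((quotHom (lowerCentral K n L 2)).comp π).ker 2).toSubmodule) =
          Submodule.Quotient.mk f := by
  obtain ⟨q, rfl⟩ := Nat.exists_eq_add_of_le' hn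
  have hA : ∀ x : Fin (q + 2) → L ⧸ (lowerCentral K (q + 2) L 2).toSubmodule,
      nbr K (q + 2) x = 0 := fun _ =>
    (Submodule.Quotient.mk_eq_zero _).2 (mem_lowerCentral_two _)
  -- Here `m ≥ 2` enters: with `n = q + 2` the dimension `mn + 1` must exceed `n + 1`.
  have h3 : (lowerCentral K (q + 2) (FreeNLie K (q + 2) X) 3).toSubmodule ≤
      (bracketIdeal π.ker).toSubmodule :=
    lowerCentral_three_le_bracketIdeal_ker hL (by rw [hdim]; nlinarith) π hπ
  have h4 : (lowerCentral K (q + 2) (FreeNLie K (q + 2) X) 4).toSubmodule ≤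
      (gammaSucc π.ker 2).toSubmodule := bracketIdeal_mono h3
  have h3π := hL.lowerCentral_three_le_ker π
  have hγ : (gammaSucc π.ker 2).toSubmodule =
      (gammaSucc ((quotHom (lowerCentral K (q + 2) L 2)).comp π).ker 2).toSubmodule :=
    congrArg (fun I => (bracketIdeal I).toSubmodule) (bracketIdeal_ker_quotHom_comp hπ h3).symm
  have hfinL : Module.Finite K L := Module.finite_of_finrank_pos (by omega)
  have hrank : Module.finrank K (L ⧸ (lowerCentral K (q + 2) L 2).toSubmodule) = m * (q + 2) := by
    have h := (lowerCentral K (q + 2) L 2).toSubmodule.finrank_quotient_add_finrank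
    rw [hL.2, hdim] at h
    exact Nat.succ.inj h
  have hfinQ := FreeNLie.finite_lowerCentralQuot (K := K) (q + 1) (m * (q + 2))
  obtain ⟨e⟩ := exists_lowerCentralQuot_equiv hA (Module.finBasisOfFinrankEq K _ hrank)
    ((quotHom (lowerCentral K (q + 2) L 2)).comp π)
    ((Submodule.mkQ_surjective _).comp hπ) π hγ h3π
  let b : lowerCentralQuot K (q + 2) (m * (q + 2)) 3 ≃ₗ[K]
      AbelianNLie K (q + 2) (basicNumber K (q + 2) (m * (q + 2)) 3) :=
    (Module.finBasisOfFinrankEq K (lowerCentralQuot K (q + 2) (m * (q + 2)) 3) rfl).equivFun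
  refine ⟨⟨⟨e.symm.trans b, fun x => ?_⟩⟩, fun _ => ?_, hA,
    exists_nilMultiplier_equiv π _ hγ h3π (fun a ha => ?_) h4⟩
  · rw [nbr_nilMultiplier_two_eq_zero π h4, map_zero]
    rfl
  · have h := FreeNLie.basicNumber_three (K := K) q (m * (q + 2))
    rw [eq_sub_iff_add_eq]
    exact_mod_cast h
  · refine mem_ker_quotHom_comp.2 ?_
    rw [LinearMap.mem_ker.1 (h3π ha)]
    exact Submodule.zero_mem _
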